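/- Let $s=(s[1],\dots,s[n])$ be a sequence of strings, each $s[i]$ being an all-$0$ string whose length $|s[i]|$ lies in $\{1,\dots,a\}$, and let $p_i=\sum_{k\le i}(|s[k]|+1)$ be the position of the $i$-th question mark in the string $s[1]\circ{?}\circ s[2]\circ{?}\circ\cdots\circ s[n]\circ{?}$. A $?$-to-$?$ self-matching is a sequence $w=((i_1,j_1),\dots,(i_m,j_m))$ of pairs in $[n]\times[n]$ with $i_1<\dots<i_m$ and $j_1<\dots<j_m$ (the $i_r$-th question mark is matched to the $j_r$-th). The match $(i_r,j_r)$ is undesired if $i_r\ne j_r$ and $p_{i_r}-p_{i_{r-1}}=p_{j_r}-p_{j_{r-1}}$, where for $r=1$ the second condition is replaced by $p_{i_1}=p_{j_1}$. The sequence $s$ is a $(\Lambda,a)$ synchronization separator sequence of length $n$ if every $?$-to-$?$ self-matching has at most $\Lambda$ undesired matches. Then $(\Lambda,a)$ synchronization separator sequences of length $n$ can be constructed explicitly for $a=(n/\Lambda)^{\Theta(1)}$ a power of $2$, provided that the constant hidden in $\Theta$ is large enough. Precisely: there are a constant $c\in\mathbb N$, a polynomial $P$ and a deterministic algorithm (a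 program for a random access machine whose arithmetic operations are addition and truncated subtraction, each instruction counting as one step) such that for all $n,\Lambda\in\mathbb N$ with $\Lambda\ge 1$ and every power of two $a$ with $a\ge (n/\Lambda)^{c}$, the algorithm, on input $(n,\Lambda,a)$, halts after at most $P(n)$ steps and outputs (the list of lengths of) a $(\Lambda,a)$ synchronization separator sequence of length $n$. -/

import Mathlib

/-! ## Synchronization separator sequences -/

/-- A sequence `s[1], …, s[n]` of all-`0` strings is given by the lengths `s i` of its members
(indices start at `0` here).  `markPos s i` is the position (counted from `1`) of the question mark
with index `i` in the string `s[1] ∘ ? ∘ s[2] ∘ ? ∘ ⋯ ∘ s[n] ∘ ?`: the members up to `s i` and their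
question marks are exactly what precedes it, itself included. -/
def markPos {n : ℕ} (s : Fin n → ℕ) (i : Fin n) : ℕ :=
  ∑ k ∈ Finset.Iic i, (s k + 1)

/-- A `?`-to-`?` self-matching: a list of pairs of indices of question marks, strictly increasing
in both coordinates. -/
def IsSelfMatching {n : ℕ} (w : List (Fin n × Fin n)) : Prop :=
  w.Pairwise fun x y => x.1 < y.1 ∧ x.2 < y.2

/-- The match of `w` with index `k`, say `(i, j)`, is undesired: `i ≠ j`, and
`p i - p i' = p j - p j'` where `(i', j')` is the immediately preceding match of `w`; if there is
no preceding match, the second condition is `p i = p j`. -/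
def IsUndesired {n : ℕ} (s : Fin n → ℕ) (w : List (Fin n × Fin n)) (k : Fin w.length) : Prop :=
  w[k].1 ≠ w[k].2 ∧
    (if (k : ℕ) = 0 then (markPos s w[k].1 : ℤ) = markPos s w[k].2
      else (markPos s w[k].1 : ℤ) - markPos s w[(k : ℕ) - 1].1
        = (markPos s w[k].2 : ℤ) - markPos s w[(k : ℕ) - 1].2)

/-- `s` is a `(L, a)` synchronization separator sequence of length `n`: all lengths lie in
`{1, …, a}` and every self-matching has at most `L` undesired matches. -/
def IsSyncSeparator {n : ℕ} (L a : ℕ) (s : Fin n → ℕ) : Prop :=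
  (∀ i, 1 ≤ s i ∧ s i ≤ a) ∧
    ∀ w : List (Fin n × Fin n), IsSelfMatching w → {k | IsUndesired s w k}.ncard ≤ L

/-! ## Random access machines

Programs act on registers and on an addressable memory, both holding natural numbers.  The only
arithmetic operations are addition and (truncated) subtraction, and every executed instruction or
test counts as one step.  As a step lengthens the binary expansions of the stored numbers by at
most a constant number of bits (there is no multiplication), running time on a multitape
Turing machine is polynomially bounded in the number of steps and the length of the input. -/

structure RamState where
  reg : ℕ → ℕ
  mem : ℕ → ℕ

inductive RamProgram where
  /-- `reg d := v` -/
  | const (d v : ℕ)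
  /-- `reg d := reg x + reg y` -/
  | plus (d x y : ℕ)
  /-- `reg d := reg x - reg y` (zero if `reg x < reg y`) -/
  | minus (d x y : ℕ)
  /-- `reg d := mem (reg x)` -/
  | load (d x : ℕ)
  /-- `mem (reg x) := reg y` -/
  | store (x y : ℕ)
  /-- `P; Q` -/
  | seq (P Q : RamProgram)
  /-- if `reg x ≠ 0` then `P` else `Q` -/
  | branch (x : ℕ) (P Q : RamProgram)
  /-- while `reg x ≠ 0` do `P` -/
  | loop (x : ℕ) (P : RamProgram)

/-- Assignment to a register. -/
def RamState.setReg (σ : RamState) (d v : ℕ) : RamState :=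
  { σ with reg := Function.update σ.reg d v }

/-- Assignment to a memory cell. -/
def RamState.setMem (σ : RamState) (d v : ℕ) : RamState :=
  { σ with mem := Function.update σ.mem d v }

/-- `RamRuns P σ t τ`: started in the state `σ`, the program `P` halts after exactly `t` steps in
the state `τ`. -/
inductive RamRuns : RamProgram → RamState → ℕ → RamState → Prop where
  | const (σ : RamState) (d v : ℕ) : RamRuns (.const d v) σ 1 (σ.setReg d v)
  | plus (σ : RamState) (d x y : ℕ) :
      RamRuns (.plus d x y) σ 1 (σ.setReg d (σ.reg x + σ.reg y))
  | minus (σ : RamState) (d x y : ℕ) :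
      RamRuns (.minus d x y) σ 1 (σ.setReg d (σ.reg x - σ.reg y))
  | load (σ : RamState) (d x : ℕ) : RamRuns (.load d x) σ 1 (σ.setReg d (σ.mem (σ.reg x)))
  | store (σ : RamState) (x y : ℕ) : RamRuns (.store x y) σ 1 (σ.setMem (σ.reg x) (σ.reg y))
  | seq {P Q : RamProgram} {σ τ υ : RamState} {t u : ℕ} :
      RamRuns P σ t τ → RamRuns Q τ u υ → RamRuns (.seq P Q) σ (t + u) υ
  | branch_nonzero {x : ℕ} {P Q : RamProgram} {σ τ : RamState} {t : ℕ} :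
      σ.reg x ≠ 0 → RamRuns P σ t τ → RamRuns (.branch x P Q) σ (1 + t) τ
  | branch_zero {x : ℕ} {P Q : RamProgram} {σ τ : RamState} {t : ℕ} :
      σ.reg x = 0 → RamRuns Q σ t τ → RamRuns (.branch x P Q) σ (1 + t) τ
  | loop_nonzero {x : ℕ} {P : RamProgram} {σ τ υ : RamState} {t u : ℕ} :
      σ.reg x ≠ 0 → RamRuns P σ t τ → RamRuns (.loop x P) τ u υ →
        RamRuns (.loop x P) σ (1 + t + u) υ
  | loop_zero {x : ℕ} {P : RamProgram} {σ : RamState} :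
      σ.reg x = 0 → RamRuns (.loop x P) σ 1 σ

/-- The initial state on input `(n, L, a)`: the three numbers are in the registers `0`, `1`, `2`;
all other registers and all memory cells are `0`. -/
def ramInput (n L a : ℕ) : RamState where
  reg := fun i => if i = 0 then n else if i = 1 then L else if i = 2 then a else 0
  mem := fun _ => 0

/-!
The lengths are chosen greedily, one after the other, so as to keep a potential small; the
potential is a sum over chains of undesired matches that dynamic programming evaluates with
additions only.

Write `p i` for the position of the question mark with index `i`. An undesired match `(i, j)` with
preceding match `(k, l)` has `i ≠ j` and satisfies `p i + p l = p j + p k`. A *chain* is a sequence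
of such pairs of matches, each starting at or above the end of the one before, and it gets the
weight `z ^ r` if it has `r` links. In every chain `max i j` increases from link to link, and for
given earlier lengths and given `(k, l)` at most one value of the length with index `max i j` makes
`(i, j)` undesired. Hence among `A` candidates the cheapest one adds at most a fraction `1 / A` of
the weight that unrestricted links would add (`IsGreedyAt.column_le`). Let a chain with end `(i,
j)` be discounted by `32 ^ (-⌊i/K⌋ - ⌊j/K⌋)`, and let `γ` bound the sums `∑ g * 32 ^ (-⌊g/K⌋)`. As
the discount is submultiplicative, the total discounted weight `Ψ` satisfies `Ψ - 1 ≤ (z γ² / A) Ψ`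
(`potential_le`), so it is at most `1 / (1 - θ)` when `z γ² ≤ θ A` and `θ < 1`. The undesired
matches of a self-matching form a chain, whence `z ^ u * 32 ^ (-2 ⌊n/K⌋) ≤ Ψ` if there are `u` of
them (`undesired_bound`).

If `n / L` is bounded away from `1`, take `K = ⌈2n / L⌉`, `z = 32` and `A = 256 K ^ 4`, which is at
most `(n / L) ^ 544`; then `u ≥ L + 1` is impossible. If `n / L` is only slightly larger than `1`,
lengths `1` and `2` have to suffice, since `a` may be `2`; here `K = 1`, `z = 1536` and `A = 2`
work, because `z` exceeds `32 ^ 2` and almost all question marks would be matched. If `n ≤ L` there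
is nothing to show. So `K`, `z` and `A` depend on `n` and `L` only (`undesired_le`, `maxLen_le`).

The algorithm is written in a small language of expressions whose only loops are folds with a fixed
number `N` of iterations, polynomial in `n`; shorter sums are obtained by guards. The compilation
of expressions is verified once (`Ex.code_spec`), and the running time of an expression is then a
polynomial in `N` that does not depend on the data.
-/

/-! ### An expression language and its compilation -/

/-- Iteration of `f` along `N - 1, …, 1, 0`, the accumulator starting at `v`. -/
def downFold (f : ℕ → ℕ → ℕ) : ℕ → ℕ → ℕ
  | 0, v => v
  | k + 1, v => downFold f k (f k v)

/-- Expressions over named variables and a memory.  `fold x y e b` iterates the body `b` a fixed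
number `N` of times, the same for all folds; `x` names the accumulator, which starts at `e`, and
`y` the index, which runs down from `N - 1` to `0`. -/
inductive Ex where
  | var (x : ℕ)
  | lit (v : ℕ)
  | add (e f : Ex)
  | sub (e f : Ex)
  | load (e : Ex)
  | ite (c e f : Ex)
  | fold (x y : ℕ) (e b : Ex)

namespace Ex

/-- The value of an expression; `N` is the number of iterations of each fold, `m` the memory and
`ρ` the assignment of values to variables. -/
def eval (N : ℕ) (m : ℕ → ℕ) : Ex → (ℕ → ℕ) → ℕ
  | var x, ρ => ρ x
  | lit v, _ => v
  | add e f, ρ => eval N m e ρ + eval N m f ρ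
  | sub e f, ρ => eval N m e ρ - eval N m f ρ
  | load e, ρ => m (eval N m e ρ)
  | ite c e f, ρ => if eval N m c ρ ≠ 0 then eval N m e ρ else eval N m f ρ
  | fold x y e b, ρ =>
      downFold (fun k v => eval N m b (Function.update (Function.update ρ x v) y k)) N
        (eval N m e ρ)

/-- Code that leaves the value of an expression in register `k` and changes no register below `k`
and no memory cell.  `Γ` says in which register (below `k`) a variable lives, and register `3`
holds the number of iterations of the folds. -/
def code : Ex → (ℕ → ℕ) → ℕ → RamProgram
  | var x, Γ, k => .seq (.const k 0) (.plus k k (Γ x))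
  | lit v, _, k => .const k v
  | add e f, Γ, k => .seq (code e Γ k) (.seq (code f Γ (k + 1)) (.plus k k (k + 1)))
  | sub e f, Γ, k => .seq (code e Γ k) (.seq (code f Γ (k + 1)) (.minus k k (k + 1)))
  | load e, Γ, k => .seq (code e Γ k) (.load k k)
  | ite c e f, Γ, k => .seq (code c Γ k) (.branch k (code e Γ k) (code f Γ k))
  | fold x y e b, Γ, k =>
      .seq (code e Γ k) <| .seq (.const (k + 1) 0) <| .seq (.plus (k + 1) (k + 1) 3) <|
        .loop (k + 1) <| .seq (.const (k + 2) 1) <| .seq (.minus (k + 1) (k + 1) (k + 2)) <|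
          .seq (code b (Function.update (Function.update Γ x k) y (k + 1)) (k + 2)) <|
            .seq (.const k 0) (.plus k k (k + 2))

/-- A bound for the number of steps of `Ex.code`, as a polynomial in the number of iterations. -/
noncomputable def time : Ex → Polynomial ℕ
  | var _ => 2
  | lit _ => 1
  | add e f => time e + time f + 1
  | sub e f => time e + time f + 1
  | load e => time e + 1
  | ite c e f => time c + time e + time f + 1
  | fold _ _ e b => time e + Polynomial.X * (time b + 5) + 3

end Ex

/-- From `σ`, the program halts after at most `T` steps in a state with property `Q`. -/
def HaltsIn (P : RamProgram) (σ : RamState) (T : ℕ) (Q : RamState → Prop) : Prop :=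
  ∃ t τ, RamRuns P σ t τ ∧ t ≤ T ∧ Q τ

namespace HaltsIn

variable {P P' : RamProgram} {σ : RamState} {T U : ℕ} {Q R : RamState → Prop}

lemma mono (h : HaltsIn P σ T Q) (hT : T ≤ U) (hQ : ∀ τ, Q τ → R τ) : HaltsIn P σ U R := by
  obtain ⟨t, τ, h, ht, hτ⟩ := h
  exact ⟨t, τ, h, ht.trans hT, hQ _ hτ⟩

lemma seq (h : HaltsIn P σ T Q) (h' : ∀ τ, Q τ → HaltsIn P' τ U R) :
    HaltsIn (.seq P P') σ (T + U) R := by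
  obtain ⟨t, τ, h, ht, hτ⟩ := h
  obtain ⟨u, υ, hh, hu, hυ⟩ := h' τ hτ
  exact ⟨t + u, υ, .seq h hh, by omega, hυ⟩

lemma const {d v : ℕ} (h : Q (σ.setReg d v)) : HaltsIn (.const d v) σ 1 Q :=
  ⟨1, _, .const σ d v, le_rfl, h⟩

lemma plus {d x y : ℕ} (h : Q (σ.setReg d (σ.reg x + σ.reg y))) : HaltsIn (.plus d x y) σ 1 Q :=
  ⟨1, _, .plus σ d x y, le_rfl, h⟩

lemma minus {d x y : ℕ} (h : Q (σ.setReg d (σ.reg x - σ.reg y))) :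
    HaltsIn (.minus d x y) σ 1 Q :=
  ⟨1, _, .minus σ d x y, le_rfl, h⟩

lemma load {d x : ℕ} (h : Q (σ.setReg d (σ.mem (σ.reg x)))) : HaltsIn (.load d x) σ 1 Q :=
  ⟨1, _, .load σ d x, le_rfl, h⟩

lemma store {x y : ℕ} (h : Q (σ.setMem (σ.reg x) (σ.reg y))) : HaltsIn (.store x y) σ 1 Q :=
  ⟨1, _, .store σ x y, le_rfl, h⟩

/-- A loop whose counter register decreases to `0`, with an invariant indexed by the counter. -/
lemma loop {x : ℕ} (I : ℕ → RamState → Prop) (hx : ∀ k τ, I k τ → τ.reg x = k)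
    (hP : ∀ k τ, I (k + 1) τ → HaltsIn P τ T (I k)) :
    ∀ k σ, I k σ → HaltsIn (.loop x P) σ (k * (T + 1) + 1) (I 0)
  | 0, σ, h => ⟨1, σ, .loop_zero (hx _ _ h), by omega, h⟩
  | k + 1, σ, h => by
    obtain ⟨t, τ, ht, htT, hτ⟩ := hP k σ h
    obtain ⟨u, υ, hu, huT, hυ⟩ := loop I hx hP k τ hτ
    refine ⟨1 + t + u, υ, .loop_nonzero (by rw [hx _ _ h]; omega) ht hu, ?_, hυ⟩
    have : (k + 1) * (T + 1) = k * (T + 1) + (T + 1) := by ring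
    omega

end HaltsIn

@[simp] lemma setReg_reg_self (σ : RamState) (d v : ℕ) : (σ.setReg d v).reg d = v := by
  simp [RamState.setReg]

lemma setReg_reg_of_ne (σ : RamState) {d r : ℕ} (v : ℕ) (h : r ≠ d) :
    (σ.setReg d v).reg r = σ.reg r := by
  simp [RamState.setReg, h]

@[simp] lemma setReg_mem (σ : RamState) (d v : ℕ) : (σ.setReg d v).mem = σ.mem := rfl

/-- `τ` results from `σ` by putting `v` into register `k` and changing registers above `k`. -/
structure Yields (k v : ℕ) (σ τ : RamState) : Prop where
  val : τ.reg k = v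
  mem : τ.mem = σ.mem
  reg : ∀ r < k, τ.reg r = σ.reg r

lemma Yields.setReg {k v w : ℕ} {σ τ : RamState} (h : Yields k v σ τ) :
    Yields k w σ (τ.setReg k w) :=
  ⟨by simp, h.mem, fun r hr => by rw [setReg_reg_of_ne _ _ hr.ne, h.reg r hr]⟩

/-- Compilation is correct: the code computes the value of the expression within the stated time. -/
lemma Ex.code_spec (e : Ex) (N : ℕ) : ∀ (Γ : ℕ → ℕ) (k : ℕ) (σ : RamState) (ρ : ℕ → ℕ),
    3 < k → σ.reg 3 = N → (∀ x, Γ x < k) → (∀ x, ρ x = σ.reg (Γ x)) →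
    HaltsIn (e.code Γ k) σ (e.time.eval N) (Yields k (e.eval N σ.mem ρ) σ) := by
  have lift : ∀ {Γ : ℕ → ℕ} {k v : ℕ} {σ τ : RamState} {ρ : ℕ → ℕ}, Yields k v σ τ → 3 < k →
      σ.reg 3 = N → (∀ x, Γ x < k) → (∀ x, ρ x = σ.reg (Γ x)) →
      τ.reg 3 = N ∧ ∀ x, ρ x = τ.reg (Γ x) := by
    intro Γ k v σ τ ρ h hk hN hΓ hρ
    exact ⟨by rw [h.reg 3 hk, hN], fun x => by rw [h.reg _ (hΓ x), hρ]⟩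
  induction e with
  | var x =>
    intro Γ k σ ρ hk hN hΓ hρ
    refine (HaltsIn.seq (HaltsIn.const (Q := fun τ => τ = σ.setReg k 0) rfl) (U := 1) ?_).mono
      (by simp [time]) fun _ h => h
    rintro _ rfl
    refine .plus ⟨?_, rfl, fun r hr => ?_⟩
    · simp [eval, hρ, setReg_reg_of_ne _ _ (hΓ x).ne]
    · rw [setReg_reg_of_ne _ _ hr.ne, setReg_reg_of_ne _ _ hr.ne]
  | lit v =>
    intro Γ k σ ρ hk hN hΓ hρ
    refine (HaltsIn.const ⟨?_, rfl, fun r hr => ?_⟩).mono (by simp [time]) fun _ h => h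
    · simp [eval]
    · rw [setReg_reg_of_ne _ _ hr.ne]
  | add e f he hf =>
    intro Γ k σ ρ hk hN hΓ hρ
    refine (HaltsIn.seq (he Γ k σ ρ hk hN hΓ hρ) (U := f.time.eval N + 1) ?_).mono
      (by simp [time]; omega) fun _ h => h
    intro τ hτ
    obtain ⟨h3, hρ'⟩ := lift hτ hk hN hΓ hρ
    refine .seq (hf Γ (k + 1) τ ρ (by omega) h3 (fun x => (hΓ x).trans (by omega)) hρ') ?_
    intro υ hυ
    refine .plus ⟨?_, by rw [setReg_mem, hυ.mem, hτ.mem], fun r hr => ?_⟩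
    · rw [setReg_reg_self, hυ.val, hυ.reg k (by omega), hτ.val, hτ.mem]; rfl
    · rw [setReg_reg_of_ne _ _ hr.ne, hυ.reg r (by omega), hτ.reg r hr]
  | sub e f he hf =>
    intro Γ k σ ρ hk hN hΓ hρ
    refine (HaltsIn.seq (he Γ k σ ρ hk hN hΓ hρ) (U := f.time.eval N + 1) ?_).mono
      (by simp [time]; omega) fun _ h => h
    intro τ hτ
    obtain ⟨h3, hρ'⟩ := lift hτ hk hN hΓ hρ
    refine .seq (hf Γ (k + 1) τ ρ (by omega) h3 (fun x => (hΓ x).trans (by omega)) hρ') ?_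
    intro υ hυ
    refine .minus ⟨?_, by rw [setReg_mem, hυ.mem, hτ.mem], fun r hr => ?_⟩
    · rw [setReg_reg_self, hυ.val, hυ.reg k (by omega), hτ.val, hτ.mem]; rfl
    · rw [setReg_reg_of_ne _ _ hr.ne, hυ.reg r (by omega), hτ.reg r hr]
  | load e he =>
    intro Γ k σ ρ hk hN hΓ hρ
    refine (HaltsIn.seq (he Γ k σ ρ hk hN hΓ hρ) (U := 1) ?_).mono
      (by simp [time]) fun _ h => h
    intro τ hτ
    refine .load ⟨?_, by rw [setReg_mem, hτ.mem], hτ.setReg.reg⟩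
    rw [setReg_reg_self, hτ.val, hτ.mem]; rfl
  | ite c e f hc he hf =>
    intro Γ k σ ρ hk hN hΓ hρ
    refine (HaltsIn.seq (hc Γ k σ ρ hk hN hΓ hρ) (U := e.time.eval N + f.time.eval N + 1) ?_).mono
      (by simp [time]; omega) fun _ h => h
    intro τ hτ
    obtain ⟨h3, hρ'⟩ := lift hτ hk hN hΓ hρ
    by_cases h0 : c.eval N σ.mem ρ = 0
    · obtain ⟨t, υ, ht, htT, hυ⟩ := hf Γ k τ ρ hk h3 hΓ hρ'
      refine ⟨1 + t, υ, .branch_zero (hτ.val.trans h0) ht, by omega, ?_, by rw [hυ.mem, hτ.mem],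
        fun r hr => by rw [hυ.reg r hr, hτ.reg r hr]⟩
      rw [hυ.val, hτ.mem]; simp [eval, h0]
    · obtain ⟨t, υ, ht, htT, hυ⟩ := he Γ k τ ρ hk h3 hΓ hρ'
      refine ⟨1 + t, υ, .branch_nonzero (by rw [hτ.val]; exact h0) ht, by omega, ?_,
        by rw [hυ.mem, hτ.mem], fun r hr => by rw [hυ.reg r hr, hτ.reg r hr]⟩
      rw [hυ.val, hτ.mem]; simp [eval, h0]
  | fold x y e b he hb =>
    intro Γ k σ ρ hk hN hΓ hρ
    set f : ℕ → ℕ → ℕ := fun j v => b.eval N σ.mem (Function.update (Function.update ρ x v) y j)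
      with hf
    set goal := downFold f N (e.eval N σ.mem ρ) with hgoal
    -- The accumulator together with the iterations that remain determines the result.
    let I : ℕ → RamState → Prop := fun j τ =>
      τ.reg (k + 1) = j ∧ τ.mem = σ.mem ∧ (∀ r < k, τ.reg r = σ.reg r) ∧
        downFold f j (τ.reg k) = goal
    refine (HaltsIn.seq (he Γ k σ ρ hk hN hΓ hρ)
      (U := 1 + (1 + (N * (b.time.eval N + 5) + 1))) ?_).mono
      (by simp [time]; omega) fun _ h => h
    intro τ hτ
    refine .seq (.const (Q := fun υ => υ = τ.setReg (k + 1) 0) rfl) ?_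
    rintro _ rfl
    refine .seq (.plus (Q := I N) ⟨?_, by simp [hτ.mem], fun r hr => ?_, ?_⟩) ?_
    · rw [setReg_reg_self, setReg_reg_self, setReg_reg_of_ne _ _ (by omega), hτ.reg 3 hk, hN,
        Nat.zero_add]
    · rw [setReg_reg_of_ne _ _ (by omega), setReg_reg_of_ne _ _ (by omega), hτ.reg r hr]
    · rw [setReg_reg_of_ne _ _ (by omega), setReg_reg_of_ne _ _ (by omega), hτ.val]
    intro υ hυ
    refine (HaltsIn.loop I (fun _ _ h => h.1) (T := b.time.eval N + 4) ?_ N υ hυ).mono le_rfl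
      fun τ' h => ⟨h.2.2.2, h.2.1, h.2.2.1⟩
    rintro j τ₀ ⟨h1, h2, h3, h4⟩
    refine (HaltsIn.seq (.const (Q := fun υ => υ = τ₀.setReg (k + 2) 1) rfl)
      (U := 1 + (b.time.eval N + (1 + 1))) ?_).mono (by omega) fun _ h => h
    rintro _ rfl
    refine .seq (.minus (Q := fun υ => υ.reg (k + 1) = j ∧ υ.mem = σ.mem ∧
      (∀ r < k, υ.reg r = σ.reg r) ∧ υ.reg k = τ₀.reg k) ⟨?_, h2, fun r hr => ?_, ?_⟩) ?_
    · rw [setReg_reg_self, setReg_reg_self, setReg_reg_of_ne _ _ (by omega), h1]; omega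
    · rw [setReg_reg_of_ne _ _ (by omega), setReg_reg_of_ne _ _ (by omega), h3 r hr]
    · rw [setReg_reg_of_ne _ _ (by omega), setReg_reg_of_ne _ _ (by omega)]
    rintro τ₁ ⟨g1, g2, g3, g4⟩
    refine .seq (hb (Function.update (Function.update Γ x k) y (k + 1)) (k + 2) τ₁
      (Function.update (Function.update ρ x (τ₀.reg k)) y j) (by omega) (by rw [g3 3 hk, hN])
      (fun u => ?_) fun u => ?_) ?_
    · have := hΓ u
      simp only [Function.update_apply]
      split_ifs <;> omega
    · simp only [Function.update_apply]
      split_ifs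
      · exact g1.symm
      · exact g4.symm
      · rw [g3 _ (hΓ u), hρ]
    intro τ₂ hτ₂
    refine .seq (.const (Q := fun υ => υ = τ₂.setReg k 0) rfl) ?_
    rintro _ rfl
    refine .plus ⟨?_, by simp [hτ₂.mem, g2], fun r hr => ?_, ?_⟩
    · rw [setReg_reg_of_ne _ _ (by omega), setReg_reg_of_ne _ _ (by omega), hτ₂.reg _ (by omega),
        g1]
    · rw [setReg_reg_of_ne _ _ (by omega), setReg_reg_of_ne _ _ (by omega), hτ₂.reg _ (by omega),
        g3 r hr]
    · rw [setReg_reg_self, setReg_reg_self, setReg_reg_of_ne _ _ (by omega), hτ₂.val, g2,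
        Nat.zero_add]
      exact h4

/-! ### Programs built from expressions -/

/-- At statement level the variables `0, …, 8` are the registers with these numbers; all other
names stand for register `9`, which is never written. -/
def topReg (x : ℕ) : ℕ := if x < 9 then x else 9

/-- The values of the variables in a state. -/
def RamState.env (σ : RamState) : ℕ → ℕ := fun x => σ.reg (topReg x)

/-- Started in variables and memory with property `pre`, the program halts within `T` steps
with property `post`. -/
def Triple (pre : (ℕ → ℕ) → (ℕ → ℕ) → Prop) (P : RamProgram) (T : ℕ)
    (post : (ℕ → ℕ) → (ℕ → ℕ) → Prop) : Prop :=
  ∀ σ : RamState, pre σ.env σ.mem → HaltsIn P σ T fun τ => post τ.env τ.mem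

/-- `x := e` -/
def assign (d : ℕ) (e : Ex) : RamProgram :=
  .seq (e.code topReg 10) (.seq (.const 11 0) (.plus d 10 11))

/-- `mem e := f` -/
def storeAt (e f : Ex) : RamProgram :=
  .seq (e.code topReg 10) (.seq (f.code topReg 11) (.store 10 11))

lemma topReg_lt (x : ℕ) : topReg x < 10 := by
  unfold topReg; split_ifs <;> omega

namespace Triple

variable {pre mid post : (ℕ → ℕ) → (ℕ → ℕ) → Prop} {P P' : RamProgram} {T U : ℕ}

lemma mono (h : Triple mid P T post) (hT : T ≤ U) (hp : ∀ ρ m, pre ρ m → mid ρ m) :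
    Triple pre P U post :=
  fun σ hσ => (h σ (hp _ _ hσ)).mono hT fun _ h => h

lemma weaken (h : Triple pre P T mid) (hp : ∀ ρ m, mid ρ m → post ρ m) : Triple pre P T post :=
  fun σ hσ => (h σ hσ).mono le_rfl fun _ h => hp _ _ h

lemma seq (h : Triple pre P T mid) (h' : Triple mid P' U post) :
    Triple pre (.seq P P') (T + U) post :=
  fun σ hσ => (h σ hσ).seq h'

lemma assign {d : ℕ} (hd : d < 9) (e : Ex) (N : ℕ)
    (h : ∀ ρ m, pre ρ m → ρ 3 = N ∧ post (Function.update ρ d (e.eval N m ρ)) m) :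
    Triple pre (assign d e) (e.time.eval N + (1 + 1)) post := by
  intro σ hσ
  obtain ⟨h3, hp⟩ := h _ _ hσ
  refine HaltsIn.seq (e.code_spec N topReg 10 σ σ.env (by omega) h3 topReg_lt fun _ => rfl) ?_
  intro τ hτ
  refine .seq (.const (Q := fun υ => υ = τ.setReg 11 0) rfl) ?_
  rintro _ rfl
  refine .plus ?_
  have : ((τ.setReg 11 0).setReg d ((τ.setReg 11 0).reg 10 + (τ.setReg 11 0).reg 11)).env =
      Function.update σ.env d (e.eval N σ.mem σ.env) := by
    funext x
    simp only [RamState.env, Function.update_apply]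
    split_ifs with hx
    · subst hx
      rw [show topReg x = x by simp [topReg, hd], setReg_reg_self, setReg_reg_self,
        setReg_reg_of_ne _ _ (by omega), hτ.val, Nat.add_zero]
    · have := topReg_lt x
      have hx' : topReg x ≠ d := by unfold topReg; split_ifs <;> omega
      rw [setReg_reg_of_ne _ _ hx', setReg_reg_of_ne _ _ (by omega), hτ.reg _ this]
  rw [this]
  simpa [hτ.mem] using hp

lemma storeAt (e f : Ex) (N : ℕ)
    (h : ∀ ρ m, pre ρ m → ρ 3 = N ∧ post ρ (Function.update m (e.eval N m ρ) (f.eval N m ρ))) :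
    Triple pre (storeAt e f) (e.time.eval N + (f.time.eval N + 1)) post := by
  intro σ hσ
  obtain ⟨h3, hp⟩ := h _ _ hσ
  refine HaltsIn.seq (e.code_spec N topReg 10 σ σ.env (by omega) h3 topReg_lt fun _ => rfl) ?_
  intro τ hτ
  refine .seq (f.code_spec N topReg 11 τ σ.env (by omega) ((hτ.reg 3 (by omega)).trans h3)
    (fun x => (topReg_lt x).trans (by omega)) fun x => (hτ.reg _ (topReg_lt x)).symm) ?_
  intro υ hυ
  refine .store ?_
  have : (υ.setMem (υ.reg 10) (υ.reg 11)).env = σ.env := by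
    funext x
    have := topReg_lt x
    simp only [RamState.env, RamState.setMem]
    rw [hυ.reg _ (by omega), hτ.reg _ this]
  rw [this]
  have h10 := hυ.reg 10 (by omega)
  simpa [RamState.setMem, hυ.val, h10, hτ.val, hυ.mem, hτ.mem] using hp

lemma loop {x : ℕ} (hx9 : x < 9) (I : ℕ → (ℕ → ℕ) → (ℕ → ℕ) → Prop)
    (hx : ∀ k ρ m, I k ρ m → ρ x = k) (hP : ∀ k, Triple (I (k + 1)) P T (I k)) (k : ℕ) :
    Triple (I k) (.loop x P) (k * (T + 1) + 1) (I 0) := by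
  intro σ hσ
  refine HaltsIn.loop (fun k τ => I k τ.env τ.mem) (fun k τ h => ?_) (fun k τ h => hP k τ h) k σ hσ
  have := hx _ _ _ h
  simpa [RamState.env, topReg, hx9] using this

end Triple

/-! ### The potential of a sequence of lengths -/

open Finset

/-- The discount of position `i`: a factor `1/32` for every `K` positions. -/
noncomputable def discount (K i : ℕ) : ℝ := (1 / 32) ^ (i / K)

lemma discount_nonneg (K i : ℕ) : 0 ≤ discount K i := by unfold discount; positivity

lemma discount_zero (K : ℕ) : discount K 0 = 1 := by simp [discount]

lemma discount_add_le (K e g : ℕ) : discount K (e + g) ≤ discount K e * discount K g := by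
  unfold discount
  rw [← pow_add]
  exact pow_le_pow_of_le_one (by norm_num) (by norm_num) (Nat.div_add_div_le_add_div)

lemma discount_anti (K : ℕ) {i j : ℕ} (h : i ≤ j) : discount K j ≤ discount K i := by
  unfold discount
  exact pow_le_pow_of_le_one (by norm_num) (by norm_num) (Nat.div_le_div_right h)

/-- The coefficient `i - e` counts the indices `k` with `e ≤ k < i`: in one coordinate, the possible
preceding matches of a match with index `i` that continues a chain with end `e`. -/
lemma sum_sub_mul_discount_le {K : ℕ} {γ : ℝ}
    (hγ : ∀ q, ∑ g ∈ range q, (g : ℝ) * discount K g ≤ γ) (e n : ℕ) :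
    ∑ i ∈ range n, ((i - e : ℕ) : ℝ) * discount K i ≤ discount K e * γ := by
  refine le_trans (b := discount K e * ∑ g ∈ range (n - e), (g : ℝ) * discount K g) ?_
    (mul_le_mul_of_nonneg_left (hγ _) (discount_nonneg _ _))
  induction n with
  | zero => simp
  | succ n ih =>
    rw [sum_range_succ]
    rcases le_or_gt e n with h | h
    · rw [Nat.succ_sub h, sum_range_succ, mul_add]
      refine add_le_add ih ?_
      have := discount_add_le K e (n - e)
      rw [Nat.add_sub_cancel' h] at this
      calc _ ≤ ((n - e : ℕ) : ℝ) * (discount K e * discount K (n - e)) :=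
            mul_le_mul_of_nonneg_left this (Nat.cast_nonneg _)
        _ = _ := by ring
    · rw [show n - e = 0 by omega] at ih ⊢
      rw [show n + 1 - e = 0 by omega]
      simpa using ih

lemma sum_mul_discount_one_le (q : ℕ) :
    ∑ g ∈ range q, (g : ℝ) * discount 1 g ≤ 32 / 961 := by
  suffices h : ∑ g ∈ range q, (g : ℝ) * discount 1 g =
      32 / 961 - (32 / 31 * q + 32 / 961) * (1 / 32) ^ q by
    rw [h]
    have : 0 ≤ (32 / 31 * (q : ℝ) + 32 / 961) * (1 / 32) ^ q := by positivity
    linarith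
  induction q with
  | zero => simp
  | succ q ih => rw [sum_range_succ, ih, discount, Nat.div_one]; push_cast; ring

lemma sum_mul_discount_le {K : ℕ} (hK : 1 ≤ K) (q : ℕ) :
    ∑ g ∈ range q, (g : ℝ) * discount K g ≤ 2 * K ^ 2 := by
  have hK0 : (0 : ℝ) ≤ K := Nat.cast_nonneg _
  refine le_trans (sum_le_sum_of_subset_of_nonneg
    (range_subset_range.2 (Nat.le_mul_of_pos_right q hK))
    fun g _ _ => mul_nonneg (Nat.cast_nonneg _) (discount_nonneg _ _)) ?_
  suffices h : ∑ g ∈ range (q * K), (g : ℝ) * discount K g ≤ K ^ 2 * (2 - 2 * (1 / 2) ^ q) by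
    refine h.trans ?_
    have : (0 : ℝ) ≤ (1 / 2) ^ q := by positivity
    nlinarith [mul_nonneg (sq_nonneg (K : ℝ)) this]
  induction q with
  | zero => simp
  | succ q ih =>
    rw [Nat.succ_mul, sum_range_add]
    -- The block of positions with quotient `q`: each term is at most `(q + 1) K / 32 ^ q`.
    have hb : ∑ g ∈ range K, ((q * K + g : ℕ) : ℝ) * discount K (q * K + g) ≤
        ∑ _g ∈ range K, ((K : ℝ) * (1 / 2) ^ q) := by
      refine sum_le_sum fun g hg => ?_
      have hg := mem_range.1 hg
      have hd : discount K (q * K + g) = (1 / 32) ^ q := by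
        rw [discount, mul_comm, Nat.mul_add_div hK, Nat.div_eq_of_lt hg, Nat.add_zero]
      have h1 : ((q * K + g : ℕ) : ℝ) ≤ K * (q + 1) := by
        have : q * K + g ≤ K * (q + 1) := by nlinarith
        exact_mod_cast this
      have h2 : ((q : ℝ) + 1) ≤ 16 ^ q := by
        have : q + 1 ≤ 16 ^ q := Nat.lt_pow_self (by norm_num)
        exact_mod_cast this
      rw [hd]
      calc _ ≤ (K * (16 : ℝ) ^ q) * (1 / 32) ^ q := by gcongr; exact h1.trans (by gcongr)
        _ = K * (1 / 2) ^ q := by rw [mul_assoc, ← mul_pow]; norm_num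
    rw [sum_const, card_range, nsmul_eq_mul] at hb
    calc _ ≤ (K : ℝ) ^ 2 * (2 - 2 * (1 / 2) ^ q) + K * (K * (1 / 2) ^ q) := add_le_add ih hb
      _ = _ := by ring

/-! ### Sums over pairs -/

lemma sum_sum_symm {R : Type*} [CommSemiring R] (F : ℕ → ℕ → R) (h : ∀ i j, F i j = F j i)
    (n : ℕ) : ∑ i ∈ range n, ∑ j ∈ range n, F i j =
      2 * ∑ t ∈ range n, ∑ i ∈ range t, F i t + ∑ t ∈ range n, F t t := by
  induction n with
  | zero => simp
  | succ n ih =>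
    have h1 : ∀ i, ∑ j ∈ range (n + 1), F i j = ∑ j ∈ range n, F i j + F i n :=
      fun i => sum_range_succ _ _
    rw [sum_congr rfl fun i _ => h1 i, sum_add_distrib, sum_range_succ, sum_range_succ,
      sum_range_succ, sum_range_succ, ih, sum_congr rfl fun j _ => h n j]
    ring

/-- The index `e` lies in `i - e` of the ranges `range (k + 1)` with `k < i`. -/
lemma sum_range_sum_range_succ {R : Type*} [CommSemiring R] (f : ℕ → R) (i n : ℕ) (h : i ≤ n) :
    ∑ k ∈ range i, ∑ e ∈ range (k + 1), f e = ∑ e ∈ range n, ((i - e : ℕ) : R) * f e := by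
  have key : ∑ k ∈ range i, ∑ e ∈ range (k + 1), f e =
      ∑ e ∈ range i, ((i - e : ℕ) : R) * f e := by
    induction i with
    | zero => simp
    | succ i ih =>
      rw [sum_range_succ, ih (by omega), sum_range_succ, sum_range_succ, ← add_assoc,
        ← sum_add_distrib]
      congr 1
      · refine sum_congr rfl fun e he => ?_
        rw [Nat.succ_sub (mem_range.1 he).le]
        push_cast; ring
      · simp
  rw [key]
  refine sum_subset (range_subset_range.2 h) fun e _ he => ?_
  rw [Nat.sub_eq_zero_of_le (not_lt.1 fun hh => he (mem_range.2 hh))]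
  simp

/-- The total weight of the empty chain and of the chains that end at or below `(i, j)`, given the
weight `E e f` of the chains with end `(e, f)`. -/
def cumul {R : Type*} [Semiring R] (E : ℕ → ℕ → R) (i j : ℕ) : R :=
  1 + ∑ e ∈ range (i + 1), ∑ f ∈ range (j + 1), E e f

lemma cumul_symm {R : Type*} [Semiring R] {E : ℕ → ℕ → R} (h : ∀ e f, E e f = E f e) (i j : ℕ) :
    cumul E i j = cumul E j i := by
  unfold cumul
  rw [sum_comm]
  simp only [fun e f => h e f]

/-- If every chain is continued by all links, whether satisfied or not, the discounted weight grows
by a factor of at most `γ ^ 2`, one factor `γ` for each coordinate. -/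
lemma sum_cumul_le {K : ℕ} {γ : ℝ} (hγ : ∀ q, ∑ g ∈ range q, (g : ℝ) * discount K g ≤ γ)
    {E : ℕ → ℕ → ℝ} (hE : ∀ e f, 0 ≤ E e f) (n : ℕ) :
    ∑ i ∈ range n, ∑ j ∈ range n, discount K i * discount K j *
        ∑ k ∈ range i, ∑ l ∈ range j, cumul E k l ≤
      γ ^ 2 * (1 + ∑ e ∈ range n, ∑ f ∈ range n, discount K e * discount K f * E e f) := by
  -- The total discount of the continuations, in one coordinate, of a chain with end `e`.
  set κ : ℕ → ℝ := fun e => ∑ i ∈ range n, ((i - e : ℕ) : ℝ) * discount K i with hκ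
  have hκ0 : ∀ e, 0 ≤ κ e := fun e =>
    sum_nonneg fun i _ => mul_nonneg (Nat.cast_nonneg _) (discount_nonneg _ _)
  have hκγ : ∀ e, κ e ≤ discount K e * γ := fun e => sum_sub_mul_discount_le hγ e n
  have hin : ∀ i ∈ range n, ∀ j ∈ range n, ∑ k ∈ range i, ∑ l ∈ range j, cumul E k l =
      (i : ℝ) * j + ∑ e ∈ range n, ∑ f ∈ range n,
        ((i - e : ℕ) : ℝ) * ((j - f : ℕ) : ℝ) * E e f := by
    intro i hi j hj
    simp only [cumul, sum_add_distrib, sum_const, card_range, nsmul_eq_mul, mul_one]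
    congr 1
    calc _ = ∑ k ∈ range i, ∑ e ∈ range (k + 1), ∑ l ∈ range j, ∑ f ∈ range (l + 1), E e f :=
          sum_congr rfl fun k _ => sum_comm
      _ = _ := by
          rw [sum_range_sum_range_succ _ i n (mem_range.1 hi).le]
          refine sum_congr rfl fun e _ => ?_
          rw [sum_range_sum_range_succ _ j n (mem_range.1 hj).le, mul_sum]
          exact sum_congr rfl fun f _ => by ring
  have hEq : ∑ i ∈ range n, ∑ j ∈ range n, discount K i * discount K j *
        ∑ k ∈ range i, ∑ l ∈ range j, cumul E k l =
      κ 0 * κ 0 + ∑ e ∈ range n, ∑ f ∈ range n, κ e * κ f * E e f := by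
    rw [sum_congr rfl fun i hi => sum_congr rfl fun j hj => by rw [hin i hi j hj, mul_add]]
    simp only [sum_add_distrib]
    congr 1
    · simp only [hκ, sum_mul_sum, Nat.sub_zero]
      exact sum_congr rfl fun i _ => sum_congr rfl fun j _ => by ring
    · have hk : ∀ e f, κ e * κ f * E e f = ∑ i ∈ range n, ∑ j ∈ range n,
          discount K i * discount K j * (((i - e : ℕ) : ℝ) * ((j - f : ℕ) : ℝ) * E e f) := by
        intro e f
        simp only [hκ, sum_mul_sum]
        simp only [sum_mul]
        exact sum_congr rfl fun i _ => sum_congr rfl fun j _ => by ring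
      simp only [hk, mul_sum]
      calc _ = ∑ i ∈ range n, ∑ e ∈ range n, ∑ j ∈ range n, ∑ f ∈ range n,
            discount K i * discount K j * (((i - e : ℕ) : ℝ) * ((j - f : ℕ) : ℝ) * E e f) :=
            sum_congr rfl fun i _ => sum_comm
        _ = ∑ e ∈ range n, ∑ i ∈ range n, ∑ f ∈ range n, ∑ j ∈ range n,
            discount K i * discount K j * (((i - e : ℕ) : ℝ) * ((j - f : ℕ) : ℝ) * E e f) := by
            rw [sum_comm]
            exact sum_congr rfl fun i _ => sum_congr rfl fun e _ => sum_comm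
        _ = _ := by
            refine sum_congr rfl fun e _ => ?_
            exact sum_comm
  rw [hEq, mul_add, mul_one, mul_sum _ _ (γ ^ 2)]
  have h0 : κ 0 ≤ γ := by simpa [discount_zero] using hκγ 0
  refine add_le_add (by nlinarith [hκ0 0]) (sum_le_sum fun e _ => ?_)
  rw [mul_sum _ _ (γ ^ 2)]
  refine sum_le_sum fun f _ => ?_
  have := mul_le_mul (hκγ e) (hκγ f) (hκ0 f) ((hκ0 e).trans (hκγ e))
  calc _ ≤ (discount K e * γ * (discount K f * γ)) * E e f :=
        mul_le_mul_of_nonneg_right this (hE e f)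
    _ = _ := by ring

/-- If in each column the discounted weight of the chains is at most a fraction `1 / A` of what the
unrestricted links would give, then the total discounted weight is bounded. -/
lemma potential_le {K n : ℕ} {γ θ A z : ℝ} (hA : 0 < A) (hz : 0 ≤ z)
    (hγ : ∀ q, ∑ g ∈ range q, (g : ℝ) * discount K g ≤ γ) (hθ : z * γ ^ 2 ≤ θ * A)
    {E : ℕ → ℕ → ℝ} (hE : ∀ e f, 0 ≤ E e f) (hs : ∀ e f, E e f = E f e) (hd : ∀ e, E e e = 0)
    (hcol : ∀ t < n, A * ∑ i ∈ range t, discount K i * E i t ≤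
      z * ∑ i ∈ range t, discount K i * ∑ k ∈ range i, ∑ l ∈ range t, cumul E k l) :
    (1 - θ) * (1 + ∑ e ∈ range n, ∑ f ∈ range n, discount K e * discount K f * E e f) ≤ 1 := by
  set Ψ := ∑ e ∈ range n, ∑ f ∈ range n, discount K e * discount K f * E e f with hΨ
  have hΨ0 : 0 ≤ Ψ := sum_nonneg fun e _ => sum_nonneg fun f _ =>
    mul_nonneg (mul_nonneg (discount_nonneg _ _) (discount_nonneg _ _)) (hE e f)
  have hc0 : ∀ k l, 0 ≤ cumul E k l := fun k l => by
    unfold cumul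
    exact add_nonneg zero_le_one (sum_nonneg fun _ _ => sum_nonneg fun _ _ => hE _ _)
  set S := ∑ i ∈ range n, ∑ j ∈ range n, discount K i * discount K j *
    ∑ k ∈ range i, ∑ l ∈ range j, cumul E k l with hS
  have h1 : Ψ = 2 * ∑ t ∈ range n, ∑ i ∈ range t, discount K i * discount K t * E i t := by
    rw [hΨ, sum_sum_symm _ fun i j => by rw [hs, mul_comm (discount K i)]]
    simp [hd]
  have h2 : 2 * ∑ t ∈ range n, ∑ i ∈ range t, discount K i * discount K t *
      ∑ k ∈ range i, ∑ l ∈ range t, cumul E k l ≤ S := by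
    rw [hS, sum_sum_symm _ fun i j => by
      rw [sum_comm, mul_comm (discount K i)]; simp only [fun k l => cumul_symm hs k l]]
    refine le_add_of_nonneg_right (sum_nonneg fun t _ => mul_nonneg ?_ ?_)
    · exact mul_nonneg (discount_nonneg _ _) (discount_nonneg _ _)
    · exact sum_nonneg fun _ _ => sum_nonneg fun _ _ => hc0 _ _
  have h3 : A * Ψ ≤ z * S := by
    calc A * Ψ = 2 * ∑ t ∈ range n, discount K t *
          (A * ∑ i ∈ range t, discount K i * E i t) := by
          rw [h1]; simp only [mul_sum]
          exact sum_congr rfl fun _ _ => sum_congr rfl fun _ _ => by ring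
      _ ≤ 2 * ∑ t ∈ range n, discount K t * (z * ∑ i ∈ range t, discount K i *
          ∑ k ∈ range i, ∑ l ∈ range t, cumul E k l) := by
          refine mul_le_mul_of_nonneg_left (sum_le_sum fun t ht => ?_) zero_le_two
          exact mul_le_mul_of_nonneg_left (hcol t (mem_range.1 ht)) (discount_nonneg _ _)
      _ = z * (2 * ∑ t ∈ range n, ∑ i ∈ range t, discount K i * discount K t *
          ∑ k ∈ range i, ∑ l ∈ range t, cumul E k l) := by
          simp only [mul_sum]
          exact sum_congr rfl fun _ _ => sum_congr rfl fun _ _ => sum_congr rfl fun _ _ =>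
            sum_congr rfl fun _ _ => by ring
      _ ≤ z * S := mul_le_mul_of_nonneg_left h2 hz
  have h4 : A * Ψ ≤ A * (θ * (1 + Ψ)) := by
    calc A * Ψ ≤ z * (γ ^ 2 * (1 + Ψ)) :=
          h3.trans (mul_le_mul_of_nonneg_left (sum_cumul_le hγ hE n) hz)
      _ ≤ θ * A * (1 + Ψ) := by
          rw [← mul_assoc]; exact mul_le_mul_of_nonneg_right hθ (by linarith)
      _ = _ := by ring
  have := le_of_mul_le_mul_left h4 hA
  linarith

/-! ### Greedy sequences -/

/-- Given the lengths in cells `0, 1, …` of the memory, the position of the question mark just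
before the string with index `t`. -/
def prefixPos (m : ℕ → ℕ) (t : ℕ) : ℕ := ∑ k ∈ range t, (m k + 1)

/-- The weight of the chains of undesired matches that end with the match `(e, f)`, as read from
the memory: the value is stored once for `(e, f)` and `(f, e)`, in the block of length `n` that
belongs to the larger index. -/
def chainWeight (n : ℕ) (m : ℕ → ℕ) (e f : ℕ) : ℕ :=
  if e < f then m (n + f * n + e) else if f < e then m (n + e * n + f) else 0

/-- The weight of the chains that can be continued by an undesired match `(i, t)` if the question
mark with index `t` is at position `x`; the summation is over the preceding match `(k, l)`. -/
def extensions (n : ℕ) (m : ℕ → ℕ) (x t i : ℕ) : ℕ :=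
  ∑ k ∈ range i, ∑ l ∈ range t,
    if prefixPos m (i + 1) + prefixPos m (l + 1) = x + prefixPos m (k + 1) then
      cumul (chainWeight n m) k l else 0

/-- What the greedy choice minimizes: the discounted weight of the chains that end in a match
`(i, t)`, scaled to an integer. -/
def columnCost (n N K : ℕ) (m : ℕ → ℕ) (x t : ℕ) : ℕ :=
  ∑ i ∈ range t, extensions n m x t i * 32 ^ (N - i / K)

/-- The length with index `t` is a cheapest one in `{1, …, A}`, and the weights of the chains that
end in a match `(i, t)` with `i < t` are stored correctly. -/
structure IsGreedyAt (n N K A z : ℕ) (m : ℕ → ℕ) (t : ℕ) : Prop where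
  one_le : 1 ≤ m t
  le : m t ≤ A
  min : ∀ v, 1 ≤ v → v ≤ A → columnCost n N K m (prefixPos m t + m t + 1) t ≤
    columnCost n N K m (prefixPos m t + v + 1) t
  table : ∀ i < t, m (n + t * n + i) = z * extensions n m (prefixPos m (t + 1)) t i

lemma chainWeight_symm (n : ℕ) (m : ℕ → ℕ) (e f : ℕ) :
    chainWeight n m e f = chainWeight n m f e := by
  unfold chainWeight; split_ifs <;> first | rfl | omega

lemma chainWeight_self (n : ℕ) (m : ℕ → ℕ) (e : ℕ) : chainWeight n m e e = 0 := by
  simp [chainWeight]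

lemma prefixPos_succ (m : ℕ → ℕ) (t : ℕ) : prefixPos m (t + 1) = prefixPos m t + m t + 1 := by
  rw [prefixPos, sum_range_succ, prefixPos, add_assoc]

lemma prefixPos_strictMono (m : ℕ → ℕ) : StrictMono (prefixPos m) :=
  strictMono_nat_of_lt_succ fun t => by rw [prefixPos_succ]; omega

lemma cumul_mono (E : ℕ → ℕ → ℕ) {i j k l : ℕ} (hi : i ≤ k) (hj : j ≤ l) :
    cumul E i j ≤ cumul E k l := by
  unfold cumul
  have hi' : range (i + 1) ⊆ range (k + 1) := range_subset_range.2 (by omega)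
  have hj' : range (j + 1) ⊆ range (l + 1) := range_subset_range.2 (by omega)
  exact Nat.add_le_add_left ((sum_le_sum_of_subset hi').trans
    (sum_le_sum fun e _ => sum_le_sum_of_subset hj')) 1

lemma le_cumul (E : ℕ → ℕ → ℕ) (i j : ℕ) : E i j ≤ cumul E i j := by
  unfold cumul
  refine le_trans ?_ (Nat.le_add_left _ _)
  refine le_trans ?_ (single_le_sum (f := fun e => ∑ f ∈ range (j + 1), E e f)
    (fun _ _ => Nat.zero_le _) (self_mem_range_succ i))
  exact single_le_sum (f := fun f => E i f) (fun _ _ => Nat.zero_le _) (self_mem_range_succ j)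

lemma cast_cumul (E : ℕ → ℕ → ℕ) (i j : ℕ) :
    ((cumul E i j : ℕ) : ℝ) = cumul (fun e f => (E e f : ℝ)) i j := by
  simp [cumul]

/-- For each preceding match, at most one length makes a given match undesired. -/
lemma sum_extensions_le (n : ℕ) (m : ℕ → ℕ) (A p t i : ℕ) :
    ∑ v ∈ Icc 1 A, extensions n m (p + v + 1) t i ≤
      ∑ k ∈ range i, ∑ l ∈ range t, cumul (chainWeight n m) k l := by
  unfold extensions
  rw [sum_comm]
  refine sum_le_sum fun k _ => ?_
  rw [sum_comm]
  refine sum_le_sum fun l _ => ?_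
  rw [← sum_filter, sum_const, smul_eq_mul]
  refine (Nat.mul_le_mul_right _ (card_le_one.2 fun v hv w hw => ?_)).trans (Nat.one_mul _).le
  have := (mem_filter.1 hv).2
  have := (mem_filter.1 hw).2
  omega

/-- The greedy choice does at least as well as the average over all lengths. -/
lemma IsGreedyAt.mul_columnCost_le {n N K A z : ℕ} {m : ℕ → ℕ} {t : ℕ}
    (h : IsGreedyAt n N K A z m t) :
    A * columnCost n N K m (prefixPos m (t + 1)) t ≤
      ∑ i ∈ range t, (∑ k ∈ range i, ∑ l ∈ range t, cumul (chainWeight n m) k l) *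
        32 ^ (N - i / K) := by
  calc A * columnCost n N K m (prefixPos m (t + 1)) t
      = ∑ _v ∈ Icc 1 A, columnCost n N K m (prefixPos m t + m t + 1) t := by
        rw [sum_const, Nat.card_Icc, Nat.add_sub_cancel, smul_eq_mul, prefixPos_succ]
    _ ≤ ∑ v ∈ Icc 1 A, columnCost n N K m (prefixPos m t + v + 1) t :=
        sum_le_sum fun v hv => h.min v (mem_Icc.1 hv).1 (mem_Icc.1 hv).2
    _ = ∑ i ∈ range t, (∑ v ∈ Icc 1 A, extensions n m (prefixPos m t + v + 1) t i) *
        32 ^ (N - i / K) := by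
        simp only [columnCost, sum_mul]
        exact sum_comm
    _ ≤ _ := sum_le_sum fun i _ => Nat.mul_le_mul_right _ (sum_extensions_le _ _ _ _ _ _)

lemma IsGreedyAt.chainWeight_eq {n N K A z : ℕ} {m : ℕ → ℕ} {t : ℕ}
    (h : IsGreedyAt n N K A z m t) {i : ℕ} (hi : i < t) :
    chainWeight n m i t = z * extensions n m (prefixPos m (t + 1)) t i := by
  rw [chainWeight, if_pos hi, h.table i hi]

/-- The averaging bound in the form that `potential_le` asks for: the common factor `32 ^ N` is
cancelled and the stored weights are put in. -/
lemma IsGreedyAt.column_le {n N K A z : ℕ} {m : ℕ → ℕ} {t : ℕ} (h : IsGreedyAt n N K A z m t)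
    (ht : t ≤ N) :
    (A : ℝ) * ∑ i ∈ range t, discount K i * (chainWeight n m i t : ℝ) ≤
      z * ∑ i ∈ range t, discount K i * ∑ k ∈ range i, ∑ l ∈ range t,
        cumul (fun e f => (chainWeight n m e f : ℝ)) k l := by
  have hw : ∀ i ∈ range t, ((32 ^ (N - i / K) : ℕ) : ℝ) = 32 ^ N * discount K i := by
    intro i hi
    have : i / K ≤ N := (Nat.div_le_self i K).trans ((mem_range.1 hi).le.trans ht)
    rw [discount, one_div, inv_pow, ← div_eq_mul_inv, eq_div_iff (by positivity)]
    push_cast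
    rw [← pow_add, Nat.sub_add_cancel this]
  have key : ((A * columnCost n N K m (prefixPos m (t + 1)) t : ℕ) : ℝ) ≤ _ :=
    Nat.cast_le.2 h.mul_columnCost_le
  have hl : ((columnCost n N K m (prefixPos m (t + 1)) t : ℕ) : ℝ) = 32 ^ N *
      ∑ i ∈ range t, discount K i * (extensions n m (prefixPos m (t + 1)) t i : ℝ) := by
    rw [columnCost, Nat.cast_sum, mul_sum]
    refine sum_congr rfl fun i hi => ?_
    rw [Nat.cast_mul, hw i hi]; ring
  have hr : ((∑ i ∈ range t, (∑ k ∈ range i, ∑ l ∈ range t, cumul (chainWeight n m) k l) *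
      32 ^ (N - i / K) : ℕ) : ℝ) = 32 ^ N * ∑ i ∈ range t, discount K i *
        ∑ k ∈ range i, ∑ l ∈ range t, cumul (fun e f => (chainWeight n m e f : ℝ)) k l := by
    rw [Nat.cast_sum, mul_sum]
    refine sum_congr rfl fun i hi => ?_
    rw [Nat.cast_mul, hw i hi, Nat.cast_sum]
    simp only [Nat.cast_sum, cast_cumul]
    ring
  rw [Nat.cast_mul, hl, hr, mul_left_comm] at key
  have key := le_of_mul_le_mul_left key (by positivity)
  calc _ = (z : ℝ) * (A * ∑ i ∈ range t,
        discount K i * (extensions n m (prefixPos m (t + 1)) t i : ℝ)) := by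
        simp only [mul_sum]
        refine sum_congr rfl fun i hi => ?_
        rw [h.chainWeight_eq (mem_range.1 hi), Nat.cast_mul]; ring
    _ ≤ _ := mul_le_mul_of_nonneg_left key (Nat.cast_nonneg _)

/-! ### Undesired matches of a greedy sequence -/

lemma markPos_eq (n : ℕ) (m : ℕ → ℕ) (i : Fin n) :
    markPos (fun i : Fin n => m i) i = prefixPos m (i + 1) := by
  unfold markPos prefixPos
  refine sum_bij (fun k _ => (k : ℕ)) (fun k hk => ?_) (fun _ _ _ _ h => Fin.ext h)
    (fun k hk => ?_) fun _ _ => rfl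
  · have hk := Fin.le_def.1 (mem_Iic.1 hk)
    exact mem_range.2 (by omega)
  · have hk := mem_range.1 hk
    exact ⟨⟨k, by omega⟩, mem_Iic.2 (Fin.le_def.2 (Nat.le_of_lt_succ hk)), rfl⟩

/-- An undesired match `(i, j)` after a match `(k, l)` multiplies the weight of a chain by `z`. -/
lemma mul_cumul_le_chainWeight {n N K A z : ℕ} {m : ℕ → ℕ}
    (h : ∀ t < n, IsGreedyAt n N K A z m t) {i j k l : ℕ} (hi : i < n) (hj : j < n)
    (hki : k < i) (hlj : l < j) (hij : i ≠ j)
    (heq : prefixPos m (i + 1) + prefixPos m (l + 1) = prefixPos m (j + 1) + prefixPos m (k + 1)) :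
    z * cumul (chainWeight n m) k l ≤ chainWeight n m i j := by
  have key : ∀ {i j k l : ℕ}, j < n → k < i → l < j → i < j →
      prefixPos m (i + 1) + prefixPos m (l + 1) = prefixPos m (j + 1) + prefixPos m (k + 1) →
      z * cumul (chainWeight n m) k l ≤ chainWeight n m i j := by
    intro i j k l hj hki hlj hij heq
    rw [(h j hj).chainWeight_eq hij]
    refine Nat.mul_le_mul_left _ ?_
    unfold extensions
    refine le_trans ?_ (single_le_sum (fun _ _ => Nat.zero_le _) (mem_range.2 hki))
    refine le_trans ?_ (single_le_sum (fun _ _ => Nat.zero_le _) (mem_range.2 hlj))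
    rw [if_pos heq]
  rcases hij.lt_or_gt with hlt | hgt
  · exact key hj hki hlj hlt heq
  · rw [chainWeight_symm, cumul_symm (chainWeight_symm n m)]
    exact key hi hlj hki hgt heq.symm

open Classical in
/-- The chain of all undesired matches of a self-matching up to a given one contributes its weight
to the total weight at that match. -/
lemma pow_count_le_cumul {n N K A z : ℕ} {m : ℕ → ℕ} (h : ∀ t < n, IsGreedyAt n N K A z m t)
    {w : List (Fin n × Fin n)} (hw : IsSelfMatching w) (r : ℕ) (hr : r < w.length) :
    z ^ Nat.count (fun r => ∃ hr : r < w.length,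
        IsUndesired (fun i : Fin n => m i) w ⟨r, hr⟩) (r + 1) ≤
      cumul (chainWeight n m) w[r].1 w[r].2 := by
  have hone : ∀ i j, 1 ≤ cumul (chainWeight n m) i j := fun i j => Nat.le_add_right _ _
  induction r with
  | zero =>
    rw [Nat.count_succ, if_neg]
    · simpa using hone _ _
    · rintro ⟨_, hne, hpos⟩
      simp only [if_true, markPos_eq, Nat.cast_inj] at hpos
      have := (prefixPos_strictMono m).injective hpos
      exact hne (Fin.ext (by simpa using this))
  | succ r ih =>
    obtain ⟨h1, h2⟩ := List.pairwise_iff_getElem.1 hw r (r + 1) (by omega) hr (by omega)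
    rw [Nat.count_succ]
    split_ifs with hu
    · obtain ⟨_, hne, hpos⟩ := hu
      simp only [Nat.add_eq_zero_iff, one_ne_zero, and_false, if_false, markPos_eq,
        Nat.add_sub_cancel] at hpos
      rw [pow_succ, mul_comm]
      refine (Nat.mul_le_mul_left z (ih (by omega))).trans ?_
      refine (mul_cumul_le_chainWeight h (w[r + 1].1).2 (w[r + 1].2).2 h1 h2
        (fun e => hne (Fin.ext e)) ?_).trans (le_cumul _ _ _)
      simp only [Fin.getElem_fin] at hpos
      omega
    · exact (ih (by omega)).trans (cumul_mono _ (Fin.le_def.1 h1.le) (Fin.le_def.1 h2.le))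

/-- The number of undesired matches in a greedy sequence is at most logarithmic in the inverse of
the total discount. -/
lemma undesired_bound {n N K A z : ℕ} {γ θ : ℝ} {m : ℕ → ℕ}
    (h : ∀ t < n, IsGreedyAt n N K A z m t) (hN : n ≤ N) (hA : 1 ≤ A) (hθ1 : θ ≤ 1)
    (hγ : ∀ q, ∑ g ∈ range q, (g : ℝ) * discount K g ≤ γ) (hθ : z * γ ^ 2 ≤ θ * A)
    {w : List (Fin n × Fin n)} (hw : IsSelfMatching w) :
    (1 - θ) * (z ^ {k | IsUndesired (fun i : Fin n => m i) w k}.ncard * discount K n ^ 2) ≤ 1 := by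
  classical
  have hpot := potential_le (n := n) (by exact_mod_cast hA : (0 : ℝ) < A) (Nat.cast_nonneg z) hγ hθ
    (E := fun e f => (chainWeight n m e f : ℝ)) (fun _ _ => Nat.cast_nonneg _)
    (fun e f => by rw [chainWeight_symm]) (fun e => by rw [chainWeight_self, Nat.cast_zero])
    fun t ht => (h t ht).column_le (ht.le.trans hN)
  refine le_trans (mul_le_mul_of_nonneg_left ?_ (by linarith)) hpot
  have hd1 : discount K n ^ 2 ≤ 1 :=
    pow_le_one₀ (discount_nonneg _ _) (by simpa [discount_zero] using discount_anti K n.zero_le)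
  have hd : discount K n ^ 2 * cumul (fun e f => (chainWeight n m e f : ℝ)) (n - 1) (n - 1) ≤
      1 + ∑ e ∈ range n, ∑ f ∈ range n,
        discount K e * discount K f * (chainWeight n m e f : ℝ) := by
    rcases Nat.eq_zero_or_pos n with rfl | hn
    · simpa [cumul, chainWeight_self] using hd1
    · rw [cumul, Nat.sub_add_cancel hn, mul_add, mul_one, mul_sum]
      refine add_le_add hd1 (sum_le_sum fun e he => ?_)
      rw [mul_sum]
      refine sum_le_sum fun f hf => mul_le_mul_of_nonneg_right ?_ (Nat.cast_nonneg _)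
      rw [sq]
      exact mul_le_mul (discount_anti K (mem_range.1 he).le) (discount_anti K (mem_range.1 hf).le)
        (discount_nonneg _ _) (discount_nonneg _ _)
  rw [mul_comm]
  refine le_trans (mul_le_mul_of_nonneg_left ?_ (sq_nonneg _)) hd
  rw [← cast_cumul]
  refine le_trans (b := ((z ^ Nat.count (fun r => ∃ hr : r < w.length,
    IsUndesired (fun i : Fin n => m i) w ⟨r, hr⟩) w.length : ℕ) : ℝ)) (le_of_eq ?_) ?_
  · rw [Nat.cast_pow, Nat.count_eq_card_filter_range, ← Set.ncard_coe_finset,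
      ← Set.ncard_image_of_injective _ (Fin.val_injective (n := w.length))]
    congr 2
    ext r
    simp only [Set.mem_image, Set.mem_ofPred_eq, coe_filter, mem_range]
    exact ⟨fun ⟨k, hk, e⟩ => e ▸ ⟨k.2, k.2, hk⟩, fun ⟨_, hr, hu⟩ => ⟨⟨r, hr⟩, hu, rfl⟩⟩
  · refine Nat.cast_le.2 ?_
    rcases Nat.eq_zero_or_pos w.length with h0 | hpos
    · obtain rfl := List.length_eq_zero_iff.1 h0
      exact Nat.le_add_right _ _
    · have := pow_count_le_cumul h hw (w.length - 1) (by omega)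
      simp only [Nat.sub_add_cancel hpos] at this
      refine this.trans (cumul_mono _ ?_ ?_) <;> omega

/-! ### The parameters -/

/-- Three regimes: every sequence will do; the bound on undesired matches is a proportion close
to `1`, to be reached with lengths `1` and `2`; the general case. -/
def maxLen (n L : ℕ) : ℕ :=
  if n ≤ L then 1 else if 36 * n ≤ 37 * L then 2 else 256 * ((2 * n) ⌈/⌉ L) ^ 4

/-- The number of positions that cost one factor `1/32`. -/
def discountStep (n L : ℕ) : ℕ :=
  if 36 * n ≤ 37 * L then 1 else (2 * n) ⌈/⌉ L

/-- The weight of one undesired match. -/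
def matchWeight (n L : ℕ) : ℕ :=
  if 36 * n ≤ 37 * L then 1536 else 32

lemma ceilDiv_mul_le {n L : ℕ} (hL : 1 ≤ L) : (2 * n) ⌈/⌉ L * L ≤ 2 * n + L := by
  rw [Nat.ceilDiv_eq_add_pred_div]
  exact (Nat.div_mul_le_self _ _).trans (by omega)

lemma le_mul_ceilDiv {n L : ℕ} (hL : 1 ≤ L) : 2 * n ≤ L * ((2 * n) ⌈/⌉ L) :=
  (ceilDiv_le_iff_le_mul hL).1 le_rfl

lemma one_le_ceilDiv {n L : ℕ} (hL : 1 ≤ L) (hn : 1 ≤ n) : 1 ≤ (2 * n) ⌈/⌉ L := by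
  by_contra h
  have := le_mul_ceilDiv (n := n) hL
  rw [show (2 * n) ⌈/⌉ L = 0 by omega] at this
  omega

lemma ceilDiv_le {n L : ℕ} (hL : 1 ≤ L) : (2 * n) ⌈/⌉ L ≤ 2 * n :=
  (ceilDiv_le_iff_le_mul hL).2 (Nat.le_mul_of_pos_left _ hL)

lemma one_le_discountStep {n L : ℕ} (hL : 1 ≤ L) : 1 ≤ discountStep n L := by
  unfold discountStep
  split_ifs with h
  · exact le_rfl
  · exact one_le_ceilDiv hL (by omega)

lemma one_le_maxLen {n L : ℕ} (hL : 1 ≤ L) : 1 ≤ maxLen n L := by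
  unfold maxLen
  split_ifs with h h'
  · exact le_rfl
  · exact one_le_two
  · have := Nat.pow_le_pow_left (one_le_ceilDiv (n := n) hL (by omega)) 4
    omega

lemma maxLen_le_poly {n L : ℕ} (hL : 1 ≤ L) : maxLen n L ≤ 5000 * n ^ 4 + 5000 := by
  unfold maxLen
  split_ifs with h h'
  · omega
  · omega
  · have := Nat.pow_le_pow_left (ceilDiv_le (n := n) hL) 4
    rw [mul_pow] at this
    omega

/-- The exponent `544 = 4 + 15 · 36` makes up for the constant factors, as `(37/36) ^ 36 ≥ 2`. -/
lemma maxLen_le {n L a : ℕ} (hL : 1 ≤ L) (ha : ∃ k, a = 2 ^ k)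
    (h : ((n : ℝ) / L) ^ 544 ≤ a) : maxLen n L ≤ a := by
  have hL0 : (0 : ℝ) < L := by exact_mod_cast hL
  unfold maxLen
  split_ifs with h1 h2
  · obtain ⟨k, rfl⟩ := ha
    exact Nat.one_le_two_pow
  · have : (1 : ℝ) < n / L := by
      rw [lt_div_iff₀ hL0, one_mul]; exact_mod_cast not_le.1 h1
    have : (1 : ℝ) < a := (one_lt_pow₀ this (by norm_num)).trans_le h
    exact_mod_cast this
  · set x : ℝ := (n : ℝ) / L with hx
    have hx1 : 37 / 36 ≤ x := by
      rw [hx, le_div_iff₀ hL0]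
      have : (37 * L : ℝ) ≤ 36 * n := by exact_mod_cast (not_le.1 h2).le
      linarith
    have h36 : (2 : ℝ) ≤ x ^ 36 := by
      have := one_add_mul_le_pow (a := (1 / 36 : ℝ)) (by norm_num) 36
      refine le_trans ?_ (pow_le_pow_left₀ (by norm_num) hx1 36)
      norm_num at this ⊢
    have hK : (((2 * n) ⌈/⌉ L : ℕ) : ℝ) ≤ 3 * x := by
      rw [hx, ← mul_div_assoc, le_div_iff₀ hL0]
      have := ceilDiv_mul_le (n := n) hL
      have : (2 * n) ⌈/⌉ L * L ≤ 3 * n := by omega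
      exact_mod_cast this
    have : ((256 * ((2 * n) ⌈/⌉ L) ^ 4 : ℕ) : ℝ) ≤ a := by
      push_cast
      calc (256 : ℝ) * (((2 * n) ⌈/⌉ L : ℕ) : ℝ) ^ 4 ≤ 256 * (3 * x) ^ 4 := by gcongr
        _ = 20736 * x ^ 4 := by ring
        _ ≤ (x ^ 36) ^ 15 * x ^ 4 := by
            refine mul_le_mul_of_nonneg_right ?_ (by positivity)
            exact le_trans (by norm_num) (pow_le_pow_left₀ zero_le_two h36 15)
        _ = x ^ 544 := by ring
        _ ≤ a := h
    exact_mod_cast this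

/-- Each regime contradicts `undesired_bound` if there are at least `L + 1` undesired matches. -/
lemma undesired_le {n N L : ℕ} {m : ℕ → ℕ} (hL : 1 ≤ L) (hN : n ≤ N)
    (h : ∀ t < n, IsGreedyAt n N (discountStep n L) (maxLen n L) (matchWeight n L) m t)
    {w : List (Fin n × Fin n)} (hw : IsSelfMatching w) :
    {k | IsUndesired (fun i : Fin n => m i) w k}.ncard ≤ L := by
  by_cases hnL : n ≤ L
  · have hlen : w.length ≤ n := by
      have : (w.map Prod.fst).Nodup :=
        List.pairwise_map.2 (List.Pairwise.imp (fun h => h.1.ne) hw)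
      simpa using this.length_le_card
    refine (Set.ncard_le_card _).trans ?_
    simpa using hlen.trans hnL
  by_contra! hcon
  by_cases hreg : 36 * n ≤ 37 * L
  · rw [discountStep, maxLen, matchWeight, if_neg hnL, if_pos hreg, if_pos hreg, if_pos hreg] at h
    have hb := undesired_bound (γ := 32 / 961) (θ := 6 / 7) h hN one_le_two (by norm_num)
      sum_mul_discount_one_le (by norm_num) hw
    set u := {k | IsUndesired (fun i : Fin n => m i) w k}.ncard
    obtain ⟨d, hd⟩ := Nat.exists_eq_add_of_le (show L + 1 ≤ n by omega)
    obtain ⟨e, he⟩ := Nat.exists_eq_add_of_le (show 36 * d + 37 ≤ L + 1 by omega)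
    have h1 : (1536 : ℝ) ^ (L + 1) ≤ 1536 ^ u := pow_le_pow_right₀ (by norm_num) hcon
    have h2 : discount 1 n ^ 2 = (1 / 1024) ^ (L + 1) * (1 / 1024) ^ d := by
      rw [discount, Nat.div_one, ← pow_mul, mul_comm n 2, pow_mul, ← pow_add, ← hd]; norm_num
    -- Only `d` indices remain beyond `L + 1`, and `L + 1 ≥ 36 d + 37`: the excess `1536 / 1024`
    -- of the weight over the discount outweighs them.
    have h3 : (7 : ℝ) * 1024 ^ d < (3 / 2) ^ (L + 1) := by
      rw [he, pow_add, pow_add, pow_mul]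
      have a1 : (1024 : ℝ) ^ d ≤ ((3 / 2) ^ 36) ^ d :=
        pow_le_pow_left₀ (by norm_num) (by norm_num) d
      have a2 : (1 : ℝ) ≤ (3 / 2) ^ e := one_le_pow₀ (by norm_num)
      have a3 : (0 : ℝ) < 1024 ^ d := by positivity
      calc (7 : ℝ) * 1024 ^ d < (3 / 2) ^ 37 * 1024 ^ d := by
            refine mul_lt_mul_of_pos_right (by norm_num) a3
        _ ≤ ((3 / 2) ^ 36) ^ d * (3 / 2) ^ 37 := by rw [mul_comm]; gcongr
        _ ≤ _ := le_mul_of_one_le_right (by positivity) a2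
    have h4 : (3 / 2 : ℝ) ^ (L + 1) * (1 / 1024) ^ d ≤ 1536 ^ u * discount 1 n ^ 2 := by
      rw [h2, show (3 / 2 : ℝ) = 1536 * (1 / 1024) by norm_num, mul_pow, mul_assoc]
      exact mul_le_mul_of_nonneg_right h1 (by positivity)
    have h5 : (7 : ℝ) < (3 / 2) ^ (L + 1) * (1 / 1024) ^ d := by
      rw [one_div, inv_pow, ← div_eq_mul_inv, lt_div_iff₀ (by positivity)]
      exact h3
    push_cast at hb
    linarith
  · have hK := one_le_discountStep (n := n) hL
    rw [discountStep, maxLen, matchWeight, if_neg hnL, if_neg hreg, if_neg hreg, if_neg hreg] at h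
    rw [discountStep, if_neg hreg] at hK
    set K := (2 * n) ⌈/⌉ L with hKdef
    have hKL : 2 * n ≤ L * K := le_mul_ceilDiv hL
    have hA : 1 ≤ 256 * K ^ 4 := by
      have := Nat.pow_le_pow_left hK 4
      omega
    have hb := undesired_bound (γ := 2 * K ^ 2) (θ := 1 / 2) h hN hA (by norm_num)
      (sum_mul_discount_le hK) (le_of_eq (by push_cast; ring)) hw
    set u := {k | IsUndesired (fun i : Fin n => m i) w k}.ncard
    have hq : 2 * (n / K) ≤ L := by
      have h1 := Nat.div_mul_le_self n K
      by_contra! hlt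
      have := Nat.mul_le_mul_right K (Nat.succ_le_of_lt hlt)
      have h2 : L.succ * K = L * K + K := Nat.succ_mul _ _
      have h3 : 2 * (n / K) * K = 2 * (n / K * K) := by ring
      omega
    have h1 : (32 : ℝ) ^ (L + 1) ≤ 32 ^ u := pow_le_pow_right₀ (by norm_num) hcon
    have h2 : (1 / 32 : ℝ) ^ L ≤ discount K n ^ 2 := by
      rw [discount, ← pow_mul]
      exact pow_le_pow_of_le_one (by norm_num) (by norm_num) (by omega)
    have h3 : (32 : ℝ) ^ (L + 1) * (1 / 32) ^ L = 32 := by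
      rw [pow_succ, mul_right_comm, ← mul_pow]; norm_num
    have h4 : (32 : ℝ) ^ (L + 1) * (1 / 32) ^ L ≤ 32 ^ u * discount K n ^ 2 :=
      mul_le_mul h1 h2 (by positivity) (by positivity)
    push_cast at hb
    linarith

/-- Greedy sequences with these parameters are synchronization separator sequences. -/
lemma isSyncSeparator_of_isGreedyAt {n N L a : ℕ} {m : ℕ → ℕ} (hL : 1 ≤ L) (hN : n ≤ N)
    (ha : ∃ k, a = 2 ^ k) (hc : ((n : ℝ) / L) ^ 544 ≤ a)
    (h : ∀ t < n, IsGreedyAt n N (discountStep n L) (maxLen n L) (matchWeight n L) m t) :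
    IsSyncSeparator L a fun i : Fin n => m i :=
  ⟨fun i => ⟨(h i i.2).one_le, (h i i.2).le.trans (maxLen_le hL ha hc)⟩,
    fun _ hw => undesired_le hL hN h hw⟩

/-! ### Expressions for the greedy choice -/

lemma downFold_congr {f g : ℕ → ℕ → ℕ} {N : ℕ} (h : ∀ k < N, ∀ v, f k v = g k v) (v : ℕ) :
    downFold f N v = downFold g N v := by
  induction N generalizing v with
  | zero => rfl
  | succ N ih =>
    rw [downFold, downFold, h N N.lt_succ_self, ih fun k hk => h k (hk.trans N.lt_succ_self)]

lemma downFold_sum (f : ℕ → ℕ) (c N v : ℕ) :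
    downFold (fun k v => if k < c then v + f k else v) N v = v + ∑ k ∈ range (min N c), f k := by
  induction N generalizing v with
  | zero => simp [downFold]
  | succ N ih =>
    rw [downFold, ih]
    split_ifs with h
    · rw [min_eq_left (Nat.succ_le_of_lt h), min_eq_left h.le, sum_range_succ]; omega
    · rw [min_eq_right (by omega), min_eq_right (by omega)]

lemma downFold_scale (b q N v : ℕ) :
    downFold (fun k v => if q ≤ k then b * v else v) N v = v * b ^ (N - q) := by
  induction N generalizing v with
  | zero => simp [downFold]
  | succ N ih =>
    rw [downFold, ih]
    split_ifs with h
    · rw [Nat.succ_sub h, pow_succ]; ring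
    · rw [show N - q = 0 by omega, show N + 1 - q = 0 by omega]

/-- A fold that keeps the better of the current candidate and `k + 1` finds a minimum of `D`. -/
lemma downFold_argmin (D : ℕ → ℕ) (A N v : ℕ) :
    let r := downFold (fun k v => if k < A then if D (k + 1) < D v then k + 1 else v else v) N v
    (r = v ∨ 1 ≤ r ∧ r ≤ A) ∧ D r ≤ D v ∧ ∀ k < N, k < A → D r ≤ D (k + 1) := by
  induction N generalizing v with
  | zero => simp [downFold]
  | succ N ih =>
    intro r
    obtain ⟨h1, h2, h3⟩ :=
      ih (if N < A then if D (N + 1) < D v then N + 1 else v else v)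
    change (r = _ ∨ 1 ≤ r ∧ r ≤ A) at h1
    change D r ≤ _ at h2
    refine ⟨?_, ?_, fun k hk hkA => ?_⟩
    · split_ifs at h1 <;> omega
    · refine h2.trans ?_
      split_ifs <;> omega
    · rcases Nat.lt_succ_iff_lt_or_eq.1 hk with hk | rfl
      · exact h3 k hk hkA
      · rw [if_pos hkA] at h2
        refine h2.trans ?_
        split_ifs <;> omega

namespace Ex

/-- The sum of `b` over the values of the variable `y` below `c`; the accumulator is the variable
`22`.  The value of `c` must not exceed the number of iterations of the folds. -/
def sum (y : ℕ) (c b : Ex) : Ex :=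
  fold 22 y (lit 0) (ite (sub c (var y)) (add (var 22) b) (var 22))

lemma eval_sum {N c₀ y : ℕ} {m ρ : ℕ → ℕ} {c b : Ex} (f : ℕ → ℕ) (hy : y ≠ 22) (hN : c₀ ≤ N)
    (hc : ∀ u k, c.eval N m (Function.update (Function.update ρ 22 u) y k) = c₀)
    (hb : ∀ u k, k < c₀ → b.eval N m (Function.update (Function.update ρ 22 u) y k) = f k) :
    (sum y c b).eval N m ρ = ∑ k ∈ range c₀, f k := by
  rw [sum, eval, downFold_congr (g := fun k v => if k < c₀ then v + f k else v), downFold_sum,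
    min_eq_right hN]
  · simp [eval]
  · intro k _ v
    simp only [eval, hc, Function.update_self, Function.update_of_ne hy.symm, Nat.sub_ne_zero_iff_lt]
    split_ifs with h
    · rw [hb v k h]
    · rfl

/-- The product, by repeated addition; the value of `a` must not exceed the number of iterations
of the folds. -/
def mul (a b : Ex) : Ex := sum 20 a b

lemma eval_mul {N a₀ b₀ : ℕ} {m ρ : ℕ → ℕ} {a b : Ex} (hN : a₀ ≤ N)
    (ha : ∀ u k, a.eval N m (Function.update (Function.update ρ 22 u) 20 k) = a₀)
    (hb : ∀ u k, b.eval N m (Function.update (Function.update ρ 22 u) 20 k) = b₀) :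
    (mul a b).eval N m ρ = a₀ * b₀ := by
  rw [mul, eval_sum (fun _ => b₀) (by norm_num) hN ha fun u k _ => hb u k]
  simp

/-- The position of the question mark just before the string with index `c`. -/
def prefixPos (c : Ex) : Ex := sum 10 c (add (load (var 10)) (lit 1))

lemma eval_prefixPos {N c₀ : ℕ} {m ρ : ℕ → ℕ} {c : Ex} (hN : c₀ ≤ N)
    (hc : ∀ u k, c.eval N m (Function.update (Function.update ρ 22 u) 10 k) = c₀) :
    (prefixPos c).eval N m ρ = _root_.prefixPos m c₀ :=
  eval_sum _ (by norm_num) hN hc fun u k _ => by simp [eval]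

/-- The address of the weight of the chains that end in `(e, f)` and `(f, e)`, if `e < f`. -/
def cell (f e : Ex) : Ex := add (add (var 0) (mul f (var 0))) e

/-- The weight of the chains that end in a match `(e, f)`; `e`, `f` are the variables `15`, `16`. -/
def chainWeight : Ex :=
  ite (sub (var 16) (var 15)) (load (cell (var 16) (var 15)))
    (ite (sub (var 15) (var 16)) (load (cell (var 15) (var 16))) (lit 0))

lemma eval_chainWeight {N : ℕ} {m ρ : ℕ → ℕ} (h15 : ρ 15 ≤ N) (h16 : ρ 16 ≤ N) :
    chainWeight.eval N m ρ = _root_.chainWeight (ρ 0) m (ρ 15) (ρ 16) := by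
  have h1 : (mul (var 16) (var 0)).eval N m ρ = ρ 16 * ρ 0 :=
    eval_mul h16 (by simp [eval]) (by simp [eval])
  have h2 : (mul (var 15) (var 0)).eval N m ρ = ρ 15 * ρ 0 :=
    eval_mul h15 (by simp [eval]) (by simp [eval])
  simp only [chainWeight, cell, eval, h1, h2, _root_.chainWeight, Nat.sub_ne_zero_iff_lt]

/-- The weight of the chains that end at or below `(k, l)`; these are the variables `13`, `14`. -/
def cumul : Ex :=
  add (lit 1) (sum 15 (add (var 13) (lit 1)) (sum 16 (add (var 14) (lit 1)) chainWeight))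

lemma eval_cumul {N : ℕ} {m ρ : ℕ → ℕ} (h13 : ρ 13 < N) (h14 : ρ 14 < N) :
    cumul.eval N m ρ = _root_.cumul (_root_.chainWeight (ρ 0) m) (ρ 13) (ρ 14) := by
  rw [cumul, eval, eval, _root_.cumul]
  congr 1
  refine eval_sum _ (by norm_num) h13 (by simp [eval]) fun u e he => ?_
  refine eval_sum _ (by norm_num) h14 (by simp [eval]) fun u' f hf => ?_
  rw [eval_chainWeight] <;> simp <;> omega

/-- The chains that an undesired match `(i, t)` continues, where `i`, `t` are the variables `8`,
`7` and `x` is the position of the question mark with index `t`. -/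
def extensions (x : Ex) : Ex :=
  -- `p = q` if and only if both truncated differences vanish.
  let p := add (prefixPos (add (var 8) (lit 1))) (prefixPos (add (var 14) (lit 1)))
  let q := add x (prefixPos (add (var 13) (lit 1)))
  sum 13 (var 8) <| sum 14 (var 7) <| ite (add (sub p q) (sub q p)) (lit 0) cumul

lemma eval_extensions {N x₀ : ℕ} {m ρ : ℕ → ℕ} {x : Ex} (h8 : ρ 8 < N) (h7 : ρ 7 ≤ N)
    (hx : ∀ ρ' : ℕ → ℕ, (∀ y, y ≠ 13 → y ≠ 14 → y ≠ 22 → ρ' y = ρ y) → x.eval N m ρ' = x₀) :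
    (extensions x).eval N m ρ = _root_.extensions (ρ 0) m x₀ (ρ 7) (ρ 8) := by
  refine eval_sum _ (by norm_num) h8.le (by simp [eval]) fun u k hk => ?_
  refine eval_sum _ (by norm_num) h7 (by simp [eval]) fun u' l hl => ?_
  set ρ' := Function.update (Function.update (Function.update (Function.update ρ 22 u) 13 k) 22 u')
    14 l with hρ'
  have e7 : ρ' 7 = ρ 7 := by simp [hρ']
  have e8 : ρ' 8 = ρ 8 := by simp [hρ']
  have e0 : ρ' 0 = ρ 0 := by simp [hρ']
  have e13 : ρ' 13 = k := by simp [hρ']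
  have e14 : ρ' 14 = l := by simp [hρ']
  have hx' : x.eval N m ρ' = x₀ := hx _ fun y h1 h2 h3 => by simp [hρ', h1, h2, h3]
  have hi : (prefixPos (add (var 8) (lit 1))).eval N m ρ' = _root_.prefixPos m (ρ 8 + 1) :=
    eval_prefixPos h8 (by simp [eval, e8])
  have hl' : (prefixPos (add (var 14) (lit 1))).eval N m ρ' = _root_.prefixPos m (l + 1) :=
    eval_prefixPos (by omega) (by simp [eval, e14])
  have hk' : (prefixPos (add (var 13) (lit 1))).eval N m ρ' = _root_.prefixPos m (k + 1) :=
    eval_prefixPos (by omega) (by simp [eval, e13])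
  have hC : cumul.eval N m ρ' = _root_.cumul (_root_.chainWeight (ρ 0) m) k l := by
    rw [eval_cumul (by omega) (by omega), e0, e13, e14]
  simp only [eval, hx', hi, hl', hk', hC]
  split_ifs <;> first | rfl | omega

/-- The value of `e` times `32 ^ (N - i / K)`; here `i`, `K` are the variables `8`, `4`. -/
def scale (e : Ex) : Ex :=
  fold 23 24 e <| ite (sub (mul (add (var 24) (lit 1)) (var 4)) (var 8))
    (mul (lit 32) (var 23)) (var 23)

lemma eval_scale {N : ℕ} {m ρ : ℕ → ℕ} (e : Ex) (hN : 32 ≤ N) (hK : 1 ≤ ρ 4) :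
    (scale e).eval N m ρ = e.eval N m ρ * 32 ^ (N - ρ 8 / ρ 4) := by
  rw [scale, eval, ← downFold_scale]
  refine downFold_congr (fun k hk v => ?_) _
  set ρ' := Function.update (Function.update ρ 23 v) 24 k with hρ'
  have h1 : (mul (add (var 24) (lit 1)) (var 4)).eval N m ρ' = (k + 1) * ρ 4 :=
    eval_mul (by omega) (by simp [eval, hρ']) (by simp [eval, hρ'])
  have h2 : (mul (lit 32) (var 23)).eval N m ρ' = 32 * v :=
    eval_mul hN (by simp [eval]) (by simp [eval, hρ'])
  have h3 : ρ' 8 = ρ 8 := by simp [hρ']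
  have h4 : ρ' 23 = v := by simp [hρ']
  simp only [eval, h1, h2, h3, h4, Nat.sub_ne_zero_iff_lt, ← Nat.div_lt_iff_lt_mul hK,
    Nat.lt_succ_iff]

/-- The cost of the length `v` for the string with index `t`, the variable `7`. -/
def columnCost (v : Ex) : Ex :=
  sum 8 (var 7) (scale (extensions (add (add (prefixPos (var 7)) v) (lit 1))))

lemma eval_columnCost {N v₀ : ℕ} {m ρ : ℕ → ℕ} {v : Ex} (hN : 32 ≤ N) (hK : 1 ≤ ρ 4)
    (h7 : ρ 7 ≤ N)
    (hv : ∀ ρ' : ℕ → ℕ, ρ' 17 = ρ 17 → ρ' 19 = ρ 19 → v.eval N m ρ' = v₀) :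
    (columnCost v).eval N m ρ =
      _root_.columnCost (ρ 0) N (ρ 4) m (_root_.prefixPos m (ρ 7) + v₀ + 1) (ρ 7) := by
  refine eval_sum _ (by norm_num) h7 (by simp [eval]) fun u i hi => ?_
  rw [eval_scale _ hN (by simpa using hK), eval_extensions
    (x₀ := _root_.prefixPos m (ρ 7) + v₀ + 1) (by simp; omega) (by simpa using h7)]
  · simp
  intro ρ' hρ'
  have e7 : ρ' 7 = ρ 7 := by rw [hρ' 7] <;> simp
  have e17 : ρ' 17 = ρ 17 := by rw [hρ' 17] <;> simp
  have e19 : ρ' 19 = ρ 19 := by rw [hρ' 19] <;> simp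
  have hp : (prefixPos (var 7)).eval N m ρ' = _root_.prefixPos m (ρ 7) :=
    eval_prefixPos h7 (by simp [eval, e7])
  simp only [eval, hp, hv ρ' e17 e19]

/-- A cheapest length in `{1, …, A}` for the string with index `t`; here `A`, `t` are the
variables `5`, `7`. -/
def argmin : Ex :=
  fold 19 17 (lit 1) <| ite (sub (var 5) (var 17))
    (ite (sub (columnCost (var 19)) (columnCost (add (var 17) (lit 1)))) (add (var 17) (lit 1))
      (var 19)) (var 19)

lemma eval_argmin {N : ℕ} {m ρ : ℕ → ℕ} (hN : 32 ≤ N) (hK : 1 ≤ ρ 4) (h7 : ρ 7 ≤ N)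
    (h5 : 1 ≤ ρ 5) (h5N : ρ 5 ≤ N) :
    1 ≤ argmin.eval N m ρ ∧ argmin.eval N m ρ ≤ ρ 5 ∧ ∀ v, 1 ≤ v → v ≤ ρ 5 →
      _root_.columnCost (ρ 0) N (ρ 4) m (_root_.prefixPos m (ρ 7) + argmin.eval N m ρ + 1) (ρ 7) ≤
        _root_.columnCost (ρ 0) N (ρ 4) m (_root_.prefixPos m (ρ 7) + v + 1) (ρ 7) := by
  have h := downFold_argmin
    (fun v => _root_.columnCost (ρ 0) N (ρ 4) m (_root_.prefixPos m (ρ 7) + v + 1) (ρ 7)) (ρ 5) N 1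
  rw [← downFold_congr (f := fun k v => (ite (sub (var 5) (var 17))
    (ite (sub (columnCost (var 19)) (columnCost (add (var 17) (lit 1)))) (add (var 17) (lit 1))
      (var 19)) (var 19)).eval N m (Function.update (Function.update ρ 19 v) 17 k))] at h
  · obtain ⟨g1, -, g3⟩ := h
    change (argmin.eval N m ρ = 1 ∨ 1 ≤ argmin.eval N m ρ ∧ argmin.eval N m ρ ≤ ρ 5) at g1
    refine ⟨by omega, by omega, fun v hv hvA => ?_⟩
    have := g3 (v - 1) (by omega) (by omega)
    rwa [Nat.sub_add_cancel hv] at this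
  · intro k hk v
    set ρ' := Function.update (Function.update ρ 19 v) 17 k with hρ'
    have e (x : ℕ) (h1 : x ≠ 17) (h2 : x ≠ 19) : ρ' x = ρ x := by simp [hρ', h1, h2]
    have e17 : ρ' 17 = k := by simp [hρ']
    have e19 : ρ' 19 = v := by simp [hρ']
    have h4 : 1 ≤ ρ' 4 := by rwa [e 4 (by norm_num) (by norm_num)]
    have h7' : ρ' 7 ≤ N := by rwa [e 7 (by norm_num) (by norm_num)]
    have c1 := eval_columnCost (m := m) (v := var 19) (v₀ := v) hN h4 h7' fun ρ'' _ h => by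
      rw [eval, h, e19]
    have c2 := eval_columnCost (m := m) (v := add (var 17) (lit 1)) (v₀ := k + 1) hN h4 h7'
      fun ρ'' h _ => by rw [eval, eval, eval, h, e17]
    rw [e 0 (by norm_num) (by norm_num), e 4 (by norm_num) (by norm_num),
      e 7 (by norm_num) (by norm_num)] at c1 c2
    simp only [eval, c1, c2, e17, e19, e 5 (by norm_num) (by norm_num), Nat.sub_ne_zero_iff_lt]

end Ex

/-! ### The program and its verification -/

/-- The memories `m` and `m'` hold the same lengths with index below `t` and the same weights of
chains that end in a pair of indices below `t`. -/
structure AgreeBelow (n t : ℕ) (m m' : ℕ → ℕ) : Prop where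
  len : ∀ c < t, m c = m' c
  cell : ∀ e f, e < f → f < t → m (n + f * n + e) = m' (n + f * n + e)

namespace AgreeBelow

variable {n t t' : ℕ} {m m' : ℕ → ℕ}

lemma mono (h : AgreeBelow n t m m') (ht : t' ≤ t) : AgreeBelow n t' m m' :=
  ⟨fun c hc => h.len c (hc.trans_le ht), fun e f he hf => h.cell e f he (hf.trans_le ht)⟩

lemma prefixPos (h : AgreeBelow n t m m') (ht : t' ≤ t) : prefixPos m t' = prefixPos m' t' :=
  sum_congr rfl fun k hk => by rw [h.len k ((mem_range.1 hk).trans_le ht)]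

lemma cumul (h : AgreeBelow n t m m') {k l : ℕ} (hk : k < t) (hl : l < t) :
    cumul (chainWeight n m) k l = cumul (chainWeight n m') k l := by
  unfold _root_.cumul
  congr 1
  refine sum_congr rfl fun e he => sum_congr rfl fun f hf => ?_
  have he := mem_range.1 he
  have hf := mem_range.1 hf
  unfold chainWeight
  split_ifs with h1 h2
  · exact h.cell e f h1 (by omega)
  · exact h.cell f e h2 (by omega)
  · rfl

lemma extensions (h : AgreeBelow n t m m') (x : ℕ) {i : ℕ} (hi : i < t) :
    extensions n m x t i = extensions n m' x t i := by
  refine sum_congr rfl fun k hk => sum_congr rfl fun l hl => ?_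
  have hk := mem_range.1 hk
  have hl := mem_range.1 hl
  rw [h.prefixPos hi, h.prefixPos hl, h.prefixPos (hk.trans hi), h.cumul (hk.trans hi) hl]

lemma columnCost (h : AgreeBelow n t m m') (N K x : ℕ) :
    columnCost n N K m x t = columnCost n N K m' x t :=
  sum_congr rfl fun i hi => by rw [h.extensions x (mem_range.1 hi)]

/-- Being greedy at `t'` depends only on what is stored for indices up to `t'`. -/
lemma isGreedyAt {N K A z : ℕ} (h : AgreeBelow n t m m') (ht : t' < t)
    (hg : IsGreedyAt n N K A z m t') : IsGreedyAt n N K A z m' t' := by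
  have h' := h.mono ht.le
  refine ⟨?_, ?_, fun v h1 h2 => ?_, fun i hi => ?_⟩
  · rw [← h.len t' ht]; exact hg.one_le
  · rw [← h.len t' ht]; exact hg.le
  · rw [← h'.columnCost, ← h'.columnCost, ← h.len t' ht, ← h.prefixPos ht.le]
    exact hg.min v h1 h2
  · rw [← h.cell i t' hi ht, ← h.prefixPos ht, ← h'.extensions _ hi]
    exact hg.table i hi

lemma update_len (ht : t < n) (v : ℕ) : AgreeBelow n t m (Function.update m t v) :=
  ⟨fun c hc => by rw [Function.update_of_ne hc.ne],
    fun e f _ _ => by rw [Function.update_of_ne (by omega)]⟩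

lemma update_cell (ht : t < n) (i v : ℕ) :
    AgreeBelow n t m (Function.update m (n + t * n + i) v) := by
  refine ⟨fun c hc => ?_, fun e f he hf => ?_⟩
  · rw [Function.update_of_ne]
    have := Nat.zero_le (t * n)
    omega
  · rw [Function.update_of_ne]
    have h1 : (f + 1) * n ≤ t * n := Nat.mul_le_mul_right n hf
    rw [Nat.succ_mul] at h1
    omega

end AgreeBelow

namespace Ex

/-- The product with a constant. -/
def constMul (c : ℕ) (e : Ex) : Ex := mul (lit c) e

lemma eval_constMul {N c x : ℕ} {m ρ : ℕ → ℕ} (hN : c ≤ N) (hx : x ≠ 20) (hx' : x ≠ 22) :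
    (constMul c (var x)).eval N m ρ = c * ρ x :=
  eval_mul hN (by simp [eval]) (by simp [eval, hx, hx'])

/-- `⌈2n / L⌉`, as the number of `k` with `k L < 2 n`. -/
def ceil : Ex :=
  sum 30 (add (var 0) (var 0))
    (ite (sub (add (var 0) (var 0)) (mul (var 30) (var 1))) (lit 1) (lit 0))

lemma eval_ceil {N : ℕ} {m ρ : ℕ → ℕ} (hN : 2 * ρ 0 ≤ N) (h1 : 1 ≤ ρ 1) :
    ceil.eval N m ρ = (2 * ρ 0) ⌈/⌉ ρ 1 := by
  rw [ceil, eval_sum (c₀ := 2 * ρ 0) (fun k => if k < (2 * ρ 0) ⌈/⌉ ρ 1 then 1 else 0)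
    (by norm_num) hN (by simp [eval, two_mul])]
  · rw [sum_boole, Nat.cast_id]
    have : (range (2 * ρ 0)).filter (· < (2 * ρ 0) ⌈/⌉ ρ 1) = range ((2 * ρ 0) ⌈/⌉ ρ 1) := by
      ext k
      have := ceilDiv_le (n := ρ 0) h1
      simp only [mem_filter, mem_range]
      omega
    rw [this, card_range]
  · intro u k hk
    have h : (mul (var 30) (var 1)).eval N m (Function.update (Function.update ρ 22 u) 30 k) =
        k * ρ 1 := eval_mul (by omega) (by simp [eval]) (by simp [eval])
    have h0 : Function.update (Function.update ρ 22 u) 30 k 0 = ρ 0 := by simp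
    simp only [eval, h, h0, Nat.sub_ne_zero_iff_lt]
    refine if_congr ?_ rfl rfl
    rw [← not_iff_not, not_lt, not_lt, ceilDiv_le_iff_le_mul h1, mul_comm k, two_mul]

/-- Nonzero unless `36 n ≤ 37 L`. -/
def regime : Ex := sub (constMul 36 (var 0)) (constMul 37 (var 1))

lemma eval_regime {N : ℕ} {m ρ : ℕ → ℕ} (hN : 37 ≤ N) :
    regime.eval N m ρ = 36 * ρ 0 - 37 * ρ 1 := by
  rw [regime, eval, eval_constMul (by omega) (by norm_num) (by norm_num),
    eval_constMul hN (by norm_num) (by norm_num)]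

/-- The value of `_root_.discountStep` for `n`, `L` in the variables `0`, `1`. -/
def discountStep : Ex := ite regime ceil (lit 1)

lemma eval_discountStep {N : ℕ} {m ρ : ℕ → ℕ} (hN : 37 ≤ N) (hN' : 2 * ρ 0 ≤ N) (h1 : 1 ≤ ρ 1) :
    discountStep.eval N m ρ = _root_.discountStep (ρ 0) (ρ 1) := by
  rw [discountStep, eval, eval_regime hN, eval_ceil hN' h1, eval, _root_.discountStep]
  split_ifs <;> first | rfl | omega

/-- The value of `_root_.matchWeight` for `n`, `L` in the variables `0`, `1`. -/
def matchWeight : Ex := ite regime (lit 32) (lit 1536)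

lemma eval_matchWeight {N : ℕ} {m ρ : ℕ → ℕ} (hN : 37 ≤ N) :
    matchWeight.eval N m ρ = _root_.matchWeight (ρ 0) (ρ 1) := by
  rw [matchWeight, eval, eval_regime hN, eval, eval, _root_.matchWeight]
  split_ifs <;> first | rfl | omega

/-- The value of `_root_.maxLen` for `n`, `L` in the variables `0`, `1`; in the general regime the
variable `4` holds `⌈2n / L⌉`. -/
def maxLen : Ex :=
  ite (sub (var 0) (var 1)) (ite regime
    (mul (var 4) (mul (var 4) (mul (var 4) (constMul 256 (var 4))))) (lit 2)) (lit 1)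

lemma eval_maxLen {N : ℕ} {m ρ : ℕ → ℕ} (hN : 256 ≤ N)
    (h4 : ρ 4 = _root_.discountStep (ρ 0) (ρ 1)) (h4N : ρ 4 ≤ N) :
    maxLen.eval N m ρ = _root_.maxLen (ρ 0) (ρ 1) := by
  have hc : ∀ ρ' : ℕ → ℕ, ρ' 4 = ρ 4 → (constMul 256 (var 4)).eval N m ρ' = 256 * ρ 4 :=
    fun ρ' h => by rw [eval_constMul hN (by norm_num) (by norm_num), h]
  have hm : (mul (var 4) (mul (var 4) (mul (var 4) (constMul 256 (var 4))))).eval N m ρ =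
      ρ 4 * (ρ 4 * (ρ 4 * (256 * ρ 4))) := by
    refine eval_mul h4N (by simp [eval]) fun u k => ?_
    refine eval_mul h4N (by simp [eval]) fun u k => ?_
    exact eval_mul h4N (by simp [eval]) fun u k => hc _ (by simp)
  have hr : regime.eval N m ρ = 36 * ρ 0 - 37 * ρ 1 := eval_regime (by omega)
  simp only [maxLen, eval, hm, hr, _root_.maxLen]
  unfold _root_.discountStep at h4
  split_ifs with h1 h2 h3 h3 <;> try omega
  rw [if_neg h3] at h4
  rw [h4]
  ring

/-- The weight of the chains that end in the match `(i, t)`; the variables are `6` for the weight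
of an undesired match, `7` for `t` and `8` for `i`. -/
def newWeight : Ex := mul (var 6) (extensions (prefixPos (add (var 7) (lit 1))))

lemma eval_newWeight {N : ℕ} {m ρ : ℕ → ℕ} (h6 : ρ 6 ≤ N) (h7 : ρ 7 < N) (h8 : ρ 8 < N) :
    newWeight.eval N m ρ =
      ρ 6 * _root_.extensions (ρ 0) m (_root_.prefixPos m (ρ 7 + 1)) (ρ 7) (ρ 8) := by
  refine eval_mul h6 (by simp [eval]) fun u k => ?_
  rw [eval_extensions (x₀ := _root_.prefixPos m (ρ 7 + 1)) (by simpa using h8)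
    (by simpa using h7.le)]
  · simp
  intro ρ' hρ'
  have e7 : ρ' 7 = ρ 7 := by rw [hρ' 7] <;> simp
  exact eval_prefixPos h7 (by simp [eval, e7])

end Ex

open Ex

/-- Stores the weights of the chains that end in `(i, t)`, for `i = t - 1, …, 0`. -/
def fillColumn : RamProgram :=
  .loop 8 (.seq (assign 8 (.sub (.var 8) (.lit 1))) (storeAt (cell (.var 7) (.var 8)) newWeight))

/-- One greedy step, for the index `t = n - r` where register `2` holds the number `r` of strings
still to be chosen. -/
def greedyStep : RamProgram :=
  .seq (assign 7 (.sub (.var 0) (.var 2))) <| .seq (storeAt (.var 7) argmin) <|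
    .seq (assign 8 (.var 7)) <| .seq fillColumn (assign 2 (.sub (.var 2) (.lit 1)))

/-- Puts the number `5000 n ^ 4 + 5000` of iterations of the folds into register `3`; it exceeds `n`
and all parameters, as `256 ⌈2n / L⌉ ^ 4 ≤ 4096 n ^ 4`.  It has to be reached by repeated squaring, as a product needs enough iterations to be evaluated. -/
def prepareFolds : RamProgram :=
  .seq (assign 3 (.var 0)) <| .seq (assign 3 (mul (.var 3) (.var 3))) <|
    .seq (assign 3 (mul (.var 3) (.var 3))) <|
      assign 3 (.add (mul (.var 3) (.lit 5000)) (.lit 5000))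

/-- Sets up the parameters `K`, `A`, `z` in registers `4`, `5`, `6` and chooses the lengths one after
the other.  The input `a` in register `2` is overwritten unread. -/
def separatorProgram : RamProgram :=
  .seq prepareFolds <| .seq (assign 4 discountStep) <| .seq (assign 5 maxLen) <|
    .seq (assign 6 matchWeight) <| .seq (assign 2 (.var 0)) (.loop 2 greedyStep)

/-- The contents of the registers that stay constant while the sequence is built. -/
structure Params (n N K A z : ℕ) (ρ : ℕ → ℕ) : Prop where
  r0 : ρ 0 = n
  r3 : ρ 3 = N
  r4 : ρ 4 = K
  r5 : ρ 5 = A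
  r6 : ρ 6 = z

lemma Params.update {n N K A z : ℕ} {ρ : ℕ → ℕ} (h : Params n N K A z ρ) {d : ℕ} (v : ℕ)
    (hd : d = 2 ∨ d = 7 ∨ d = 8) : Params n N K A z (Function.update ρ d v) := by
  obtain ⟨h0, h3, h4, h5, h6⟩ := h
  constructor <;> rw [Function.update_of_ne (by omega)] <;> assumption

/-- A bound for the number of steps of `fillColumn`, in terms of the number of iterations of the folds. -/
noncomputable def fillColumnTime : Polynomial ℕ :=
  .X * (((Ex.sub (.var 8) (.lit 1)).time + 2 +
    ((cell (.var 7) (.var 8)).time + (newWeight.time + 1))) + 1) + 1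

/-- A bound for the number of steps of `greedyStep`, in terms of the number of iterations of the folds. -/
noncomputable def greedyStepTime : Polynomial ℕ :=
  (Ex.sub (.var 0) (.var 2)).time + 2 + ((Ex.var 7).time + (argmin.time + 1) +
    ((Ex.var 7).time + 2 + (fillColumnTime + ((Ex.sub (.var 2) (.lit 1)).time + 2))))

/-- A bound for the number of steps of `prepareFolds`, in terms of `n`. -/
noncomputable def prepareFoldsTime : Polynomial ℕ :=
  (Ex.var 0).time + 2 + ((mul (.var 3) (.var 3)).time + 2 +
    (((mul (.var 3) (.var 3)).time + 2).comp (.X ^ 2) +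
      ((Ex.add (mul (.var 3) (.lit 5000)) (.lit 5000)).time + 2).comp (.X ^ 4)))

/-- A bound for the number of steps of `separatorProgram`, in terms of `n`. -/
noncomputable def separatorTime : Polynomial ℕ :=
  prepareFoldsTime + ((Ex.discountStep.time + 2 + (Ex.maxLen.time + 2 + (Ex.matchWeight.time + 2 +
    ((Ex.var 0).time + 2 + (.X * (greedyStepTime + 1) + 1))))).comp
      (.C 5000 * .X ^ 4 + .C 5000))

section

variable {n N K A z : ℕ}

/-- The state of the computation when the length with index `t` has been chosen and the weights of
the chains that end in `(i, t)` have been stored for `i ≥ j`. -/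
structure ColumnInv (n N K A z t j : ℕ) (ρ m : ℕ → ℕ) : Prop where
  params : Params n N K A z ρ
  r2 : ρ 2 = n - t
  r7 : ρ 7 = t
  r8 : ρ 8 = j
  le : j ≤ t
  greedy : ∀ t' < t, IsGreedyAt n N K A z m t'
  one_le : 1 ≤ m t
  le_max : m t ≤ A
  min : ∀ v, 1 ≤ v → v ≤ A → columnCost n N K m (prefixPos m t + m t + 1) t ≤
    columnCost n N K m (prefixPos m t + v + 1) t
  table : ∀ i < t, j ≤ i →
    m (n + t * n + i) = z * extensions n m (prefixPos m (t + 1)) t i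

/-- Storing one more weight does not disturb what was established before. -/
lemma ColumnInv.store {t j v : ℕ} {ρ m : ℕ → ℕ} (ht : t < n)
    (h : ColumnInv n N K A z t (j + 1) ρ m)
    (hv : v = z * extensions n m (prefixPos m (t + 1)) t j) :
    ColumnInv n N K A z t j (Function.update ρ 8 j) (Function.update m (n + t * n + j) v) := by
  have hj := h.le
  have hag : AgreeBelow n t m (Function.update m (n + t * n + j) v) := .update_cell ht j v
  have hmt : Function.update m (n + t * n + j) v t = m t := by
    rw [Function.update_of_ne]
    have := Nat.zero_le (t * n)
    omega
  have hpos : prefixPos (Function.update m (n + t * n + j) v) (t + 1) = prefixPos m (t + 1) := by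
    rw [prefixPos_succ, prefixPos_succ, hmt, hag.prefixPos le_rfl]
  refine ⟨h.params.update _ (by omega), ?_, ?_, by simp, by omega,
    fun t' ht' => hag.isGreedyAt ht' (h.greedy t' ht'), by rw [hmt]; exact h.one_le,
    by rw [hmt]; exact h.le_max, fun u h1 h2 => ?_, fun i hi hji => ?_⟩
  · rw [Function.update_of_ne (by norm_num), h.r2]
  · rw [Function.update_of_ne (by norm_num), h.r7]
  · rw [hmt, ← hag.columnCost, ← hag.columnCost, ← hag.prefixPos le_rfl]
    exact h.min u h1 h2
  · rw [hpos, ← hag.extensions _ hi]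
    rcases hji.eq_or_lt with rfl | hji
    · rw [Function.update_self, hv]
    · rw [Function.update_of_ne (by omega)]
      exact h.table i hi hji

lemma fillColumn_spec (hN : n ≤ N) (hz : z ≤ N) {t : ℕ} (ht : t < n) :
    Triple (ColumnInv n N K A z t t) fillColumn (fillColumnTime.eval N)
      (ColumnInv n N K A z t 0) := by
  refine (Triple.loop (by norm_num) (fun j ρ m => ColumnInv n N K A z t j ρ m)
    (fun j ρ m h => h.r8) (T := (Ex.sub (.var 8) (.lit 1)).time.eval N + 2 +
      ((cell (.var 7) (.var 8)).time.eval N + (newWeight.time.eval N + 1))) (fun j => ?_) t).mono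
    ?_ fun _ _ h => h
  · refine Triple.seq (mid := fun ρ m => ∃ ρ₀, ColumnInv n N K A z t (j + 1) ρ₀ m ∧
      ρ = Function.update ρ₀ 8 j) (.assign (by norm_num) _ N fun ρ m h => ?_)
      (.storeAt _ _ N fun ρ m h => ?_)
    · refine ⟨h.params.r3, ρ, h, ?_⟩
      rw [eval, eval, eval, h.r8, Nat.add_sub_cancel]
    · obtain ⟨ρ₀, h, rfl⟩ := h
      have hj := h.le
      have e (x : ℕ) (hx : x ≠ 8) : Function.update ρ₀ 8 j x = ρ₀ x := by simp [hx]
      have e7 : Function.update ρ₀ 8 j 7 = t := by rw [e 7 (by norm_num), h.r7]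
      have e6 : Function.update ρ₀ 8 j 6 = z := by rw [e 6 (by norm_num), h.params.r6]
      have e0 : Function.update ρ₀ 8 j 0 = n := by rw [e 0 (by norm_num), h.params.r0]
      have e8 : Function.update ρ₀ 8 j 8 = j := by simp
      refine ⟨by rw [e 3 (by norm_num), h.params.r3], ?_⟩
      have hm : (mul (.var 7) (.var 0)).eval N m (Function.update ρ₀ 8 j) = t * n :=
        eval_mul (ht.le.trans hN) (by simp [eval, h.r7]) (by simp [eval, h.params.r0])
      have hc : (cell (.var 7) (.var 8)).eval N m (Function.update ρ₀ 8 j) = n + t * n + j := by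
        simp only [cell, eval, hm, e0, e8]
      rw [hc]
      refine h.store ht ?_
      rw [eval_newWeight (by rwa [e6]) (by omega) (by omega), e0, e6, e7, e8]
  · have : t * ((Ex.sub (.var 8) (.lit 1)).time.eval N + 2 +
        ((cell (.var 7) (.var 8)).time.eval N + (newWeight.time.eval N + 1)) + 1) ≤
        N * ((Ex.sub (.var 8) (.lit 1)).time.eval N + 2 +
        ((cell (.var 7) (.var 8)).time.eval N + (newWeight.time.eval N + 1)) + 1) :=
      Nat.mul_le_mul_right _ (ht.le.trans hN)
    simpa [fillColumnTime] using this

/-- The state of the computation when `r` strings are still to be chosen. -/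
structure GreedyInv (n N K A z r : ℕ) (ρ m : ℕ → ℕ) : Prop where
  params : Params n N K A z ρ
  r2 : ρ 2 = r
  le : r ≤ n
  greedy : ∀ t < n - r, IsGreedyAt n N K A z m t

lemma greedyStep_spec (hN : n ≤ N) (hN' : 32 ≤ N) (hz : z ≤ N) (hK : 1 ≤ K) (hA : 1 ≤ A)
    (hAN : A ≤ N) (r : ℕ) :
    Triple (GreedyInv n N K A z (r + 1)) greedyStep (greedyStepTime.eval N)
      (GreedyInv n N K A z r) := by
  by_cases hr : n ≤ r
  · exact fun σ h => absurd h.le (by omega)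
  have ht : n - (r + 1) < n := by omega
  set t := n - (r + 1) with htdef
  refine Triple.mono (mid := GreedyInv n N K A z (r + 1)) (.seq (mid := fun ρ m =>
      GreedyInv n N K A z (r + 1) ρ m ∧ ρ 7 = t)
      (.assign (by norm_num) _ N fun ρ m h => ?_) <|
    .seq (mid := fun ρ m => ∃ j, ColumnInv n N K A z t t (Function.update ρ 8 j) m)
      (.storeAt _ _ N fun ρ m h => ?_) <|
    .seq (mid := ColumnInv n N K A z t t) (.assign (by norm_num) _ N fun ρ m h => ?_) <|
    .seq (fillColumn_spec hN hz ht) (.assign (by norm_num) _ N fun ρ m h => ?_))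
    (le_of_eq (by simp [greedyStepTime])) fun _ _ h => h
  · refine ⟨h.params.r3, ⟨h.params.update _ (by omega), ?_, h.le, h.greedy⟩, ?_⟩
    · rw [Function.update_of_ne (by norm_num), h.r2]
    · rw [Function.update_self, eval, eval, eval, h.params.r0, h.r2]
  · obtain ⟨h, h7⟩ := h
    have hp := h.params
    refine ⟨hp.r3, t, ?_⟩
    obtain ⟨g1, g2, g3⟩ := eval_argmin (m := m) (ρ := ρ) hN' (by rwa [hp.r4]) (by omega)
      (by rwa [hp.r5]) (by rwa [hp.r5])
    rw [hp.r5, hp.r0, hp.r4, h7] at g3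
    rw [hp.r5] at g2
    rw [eval, h7]
    have hag : AgreeBelow n t m (Function.update m t (argmin.eval N m ρ)) := .update_len ht _
    refine ⟨hp.update _ (by omega), ?_, ?_, by simp, le_rfl,
      fun t' ht' => hag.isGreedyAt ht' (h.greedy t' ht'), by simpa using g1, by simpa using g2,
      fun v h1 h2 => ?_, fun i hi hti => absurd hti (by omega)⟩
    · rw [Function.update_of_ne (by norm_num), h.r2]; omega
    · rw [Function.update_of_ne (by norm_num), h7]
    · rw [Function.update_self, ← hag.columnCost, ← hag.columnCost, ← hag.prefixPos le_rfl]
      exact g3 v h1 h2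
  · obtain ⟨j, h⟩ := h
    have h3 := h.params.r3
    have h7 := h.r7
    rw [Function.update_of_ne (by norm_num)] at h3 h7
    refine ⟨h3, ?_⟩
    have h8 := h.r8
    rw [Function.update_self] at h8
    rw [eval, h7]
    rwa [h8] at h
  · refine ⟨h.params.r3, h.params.update _ (by omega), ?_, by omega, fun t' ht' => ?_⟩
    · rw [Function.update_self, eval, eval, eval, h.r2]; omega
    · rcases Nat.lt_or_ge t' t with hlt | hge
      · exact h.greedy t' hlt
      · obtain rfl : t' = t := by omega
        exact ⟨h.one_le, h.le_max, h.min, fun i hi => h.table i hi (Nat.zero_le i)⟩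

end

lemma prepareFolds_spec (n L : ℕ) :
    Triple (fun ρ _ => ρ 0 = n ∧ ρ 1 = L ∧ ρ 3 = 0) prepareFolds (prepareFoldsTime.eval n)
      (fun ρ _ => ρ 0 = n ∧ ρ 1 = L ∧ ρ 3 = 5000 * n ^ 4 + 5000) := by
  have hsq : ∀ (N : ℕ) (ρ m : ℕ → ℕ), ρ 3 = N → (mul (.var 3) (.var 3)).eval N m ρ = N * N :=
    fun N ρ m h => eval_mul le_rfl (by simp [eval, h]) (by simp [eval, h])
  refine Triple.mono (.seq (mid := fun ρ _ => ρ 0 = n ∧ ρ 1 = L ∧ ρ 3 = n)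
      (.assign (by norm_num) _ 0 fun ρ m h => ⟨h.2.2, ?_⟩) <|
    .seq (mid := fun ρ _ => ρ 0 = n ∧ ρ 1 = L ∧ ρ 3 = n ^ 2)
      (.assign (by norm_num) _ n fun ρ m h => ⟨h.2.2, ?_⟩) <|
    .seq (mid := fun ρ _ => ρ 0 = n ∧ ρ 1 = L ∧ ρ 3 = n ^ 4)
      (.assign (by norm_num) _ (n ^ 2) fun ρ m h => ⟨h.2.2, ?_⟩)
      (.assign (by norm_num) _ (n ^ 4) fun ρ m h => ⟨h.2.2, ?_⟩)) ?_ fun _ _ h => h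
  · simp [eval, h.1, h.2.1]
  · rw [hsq n ρ m h.2.2]
    simp [h.1, h.2.1, sq]
  · rw [hsq (n ^ 2) ρ m h.2.2]
    simp only [Function.update_self, ← pow_add]
    simp [h.1, h.2.1]
  · have : (mul (.var 3) (.lit 5000)).eval (n ^ 4) m ρ = n ^ 4 * 5000 :=
      eval_mul le_rfl (by simp [eval, h.2.2]) (by simp [eval])
    rw [eval, this, eval]
    simp [h.1, h.2.1, mul_comm]
  · simp [prepareFoldsTime, Ex.time]

/-- The program builds a greedy sequence in polynomial time. -/
lemma separatorProgram_spec {n L : ℕ} (hL : 1 ≤ L) :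
    Triple (fun ρ _ => ρ 0 = n ∧ ρ 1 = L ∧ ρ 3 = 0) separatorProgram (separatorTime.eval n)
      (fun _ m => ∀ t < n, IsGreedyAt n (5000 * n ^ 4 + 5000) (discountStep n L) (maxLen n L)
        (matchWeight n L) m t) := by
  have hn4 : n ≤ n ^ 4 := Nat.le_self_pow (by norm_num) n
  have hAN := maxLen_le_poly (n := n) hL
  have hK := one_le_discountStep (n := n) hL
  have hA := one_le_maxLen (n := n) hL
  set N := 5000 * n ^ 4 + 5000 with hN
  have hKN : discountStep n L ≤ N := by
    unfold _root_.discountStep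
    have := ceilDiv_le (n := n) hL
    split_ifs <;> omega
  have hzN : matchWeight n L ≤ N := by
    unfold _root_.matchWeight
    split_ifs <;> omega
  refine Triple.mono (.seq (prepareFolds_spec n L) <|
    .seq (mid := fun ρ _ => ρ 0 = n ∧ ρ 1 = L ∧ ρ 3 = N ∧ ρ 4 = discountStep n L)
      (.assign (by norm_num) _ N fun ρ m h => ⟨h.2.2, ?_⟩) <|
    .seq (mid := fun ρ _ => ρ 0 = n ∧ ρ 1 = L ∧ ρ 3 = N ∧ ρ 4 = discountStep n L ∧
        ρ 5 = maxLen n L)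
      (.assign (by norm_num) _ N fun ρ m h => ⟨h.2.2.1, ?_⟩) <|
    .seq (mid := fun ρ _ => Params n N (discountStep n L) (maxLen n L) (matchWeight n L) ρ)
      (.assign (by norm_num) _ N fun ρ m h => ⟨h.2.2.1, ?_⟩) <|
    .seq (mid := GreedyInv n N (discountStep n L) (maxLen n L) (matchWeight n L) n)
      (.assign (by norm_num) _ N fun ρ m h => ⟨h.r3, ?_⟩) <|
    (Triple.loop (by norm_num) _ (fun r ρ m h => h.r2) (fun r => greedyStep_spec (by omega)
      (by omega) hzN hK hA hAN r) n).weaken fun ρ m h => h.greedy) ?_ fun _ _ h => h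
  · obtain ⟨h0, h1, h3⟩ := h
    rw [eval_discountStep (by omega) (by omega) (by omega), h0, h1]
    simp [h0, h1, h3, hN]
  · obtain ⟨h0, h1, h3, h4⟩ := h
    rw [eval_maxLen (by omega) (by rw [h0, h1, h4]) (by omega), h0, h1]
    simp [h0, h1, h3, h4]
  · obtain ⟨h0, h1, h3, h4, h5⟩ := h
    rw [eval_matchWeight (by omega), h0, h1]
    constructor <;> simp [h0, h3, h4, h5]
  · refine ⟨h.update _ (by omega), ?_, le_rfl, fun t ht => absurd ht (by omega)⟩
    rw [Function.update_self, eval, h.r0]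
  · have : n * (greedyStepTime.eval N + 1) ≤ N * (greedyStepTime.eval N + 1) :=
      Nat.mul_le_mul_right _ (by omega)
    rw [separatorTime, Polynomial.eval_add]
    refine Nat.add_le_add le_rfl ?_
    have hX : (Polynomial.C 5000 * Polynomial.X ^ 4 + Polynomial.C 5000 : Polynomial ℕ).eval n =
        N := by simp [hN]
    rw [Polynomial.eval_comp, hX]
    simp only [Polynomial.eval_add, Polynomial.eval_mul, Polynomial.eval_X, Polynomial.eval_one,
      Polynomial.eval_ofNat]
    omega

theorem mainTheorem9 :
    ∃ (c : ℕ) (M : RamProgram) (p : Polynomial ℕ),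
      ∀ n L a : ℕ, 1 ≤ L → (∃ k : ℕ, a = 2 ^ k) → ((n : ℝ) / (L : ℝ)) ^ c ≤ (a : ℝ) →
        ∃ (t : ℕ) (τ : RamState),
          RamRuns M (ramInput n L a) t τ ∧ t ≤ p.eval n ∧
            IsSyncSeparator L a (fun i : Fin n => τ.mem i) := by
  refine ⟨544, separatorProgram, separatorTime, fun n L a hL ha hc => ?_⟩
  obtain ⟨t, τ, hrun, ht, hτ⟩ := separatorProgram_spec (n := n) hL (ramInput n L a)
    (by simp [RamState.env, topReg, ramInput])
  have hn4 : n ≤ n ^ 4 := Nat.le_self_pow (by norm_num) n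
  exact ⟨t, τ, hrun, ht, isSyncSeparator_of_isGreedyAt hL (by omega) ha hc hτ⟩
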